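/- Let $M\ge 2$, $N\ge 1$, and let $Y_1,\dots,Y_N$ be i.i.d. random vectors in $\{0,1\}^M$ with law $P$ (no covariates). Put $\alpha_{0j}=\mathbb P(Y_{1j}=1)$ and, for $\alpha\in(0,1)^M$, $z_j(y,\alpha)=(y_j-\alpha_j)/\sqrt{\alpha_j(1-\alpha_j)}$. For each bundle $\ell\subseteq[M]$ with $|\ell|\ge 2$ let $W_\ell(\alpha,y)=\prod_{j\in\ell}z_j(y,\alpha)$ and $r_{0\ell}=\mathbb E[W_\ell(\alpha_0,Y_1)]$. Assume that (ii) $\|r_0\|_0\le s$; (iii) $1+W(\alpha_0,y)'r_0\le\bar L$ for all $y\in\{0,1\}^M$, and with probability at least $1-\epsilon$, $1+W(\alpha_0,Y_i)'r_0>\xi_N$ for all $i\in[N]$; (iv) $\eta<\alpha_{0j}<1-\eta$ for all $j\in[M]$, for some $\eta\in(0,1)$. Let $\hat\alpha_j=\frac1N\sum_{i=1}^N Y_{ij}$, $\hat s_j=\sqrt{\hat\alpha_j(1-\hat\alpha_j)}$, and for $\delta_\alpha\in(0,1)$ let $$\mathcal A(\hat\alpha)=\prod_{j=1}^M\big[\hat\alpha_j-cv_{\delta_\alpha}\hat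 s_j,\ \hat\alpha_j+cv_{\delta_\alpha}\hat s_j\big],$$ where $cv_{\delta_\alpha}$ is the $(1-\delta_\alpha)$-quantile, conditional on $Y_1,\dots,Y_N$, of $\max_{j\in[M]}\big|\frac1N\sum_{i=1}^N\zeta_i\,(Y_{ij}-\hat\alpha_j)/\hat s_j\big|$ with $\zeta_1,\dots,\zeta_N$ i.i.d. $N(0,1)$ independent of the data (terms $j$ with $\hat s_j=0$, whose numerators all vanish, count as $0$). (a) There is an absolute constant $c_0>0$ (independent of $M$, $N$, $s$ and of all the other quantities above) such that for every $\delta\in(0,1)$, with probability at least $1-\delta$, the following three bounds hold simultaneously: $$\|\hat\alpha-\alpha_0\|_1\le\frac{M}{\sqrt N}+c_0\sqrt{\frac{M\log(1/\delta)\min\{\bar L,M/4\}}{N}},$$ $$\|\hat\alpha-\alpha_0\|_2\le\sqrt{\frac MN}+c_0\sqrt{\frac{\log(1/\delta)\min\{\bar L,M/4\}}{N}},$$ $$\|\hat\alpha-\alpha_0\|_\infty\le c_0\sqrt{\frac{\log(M/\delta)}{N}}.$$ (b) With probability at least $1-\delta_\alpha-o(1)$ as $N\to\infty$, both $\hat\alpha\in\mathcal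 A(\hat\alpha)$ and $\alpha_0\in\mathcal A(\hat\alpha)$; here $M$, $\eta$ and $\delta_\alpha$ are fixed, and the $o(1)$ term depends only on $N,M,\eta,\delta_\alpha$ (it is uniform over all laws $P$ satisfying the assumptions). -/

import Mathlib

open MeasureTheory ProbabilityTheory Filter Topology
open scoped ENNReal

noncomputable section

namespace BinaryVec

/-- Outcomes of an `M`-dimensional binary vector, i.e. elements of `{0,1}^M`. -/
abbrev Outcome (M : ℕ) : Type := Fin M → Bool

/-- The real number `0` or `1` coded by a Boolean. -/
def bit (b : Bool) : ℝ := if b then 1 else 0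

/-- The `ℓ^q` norm of a vector of `ℝ^M`. -/
def vecNorm {M : ℕ} (q : ℝ≥0∞) (v : Fin M → ℝ) : ℝ :=
  ‖(WithLp.toLp q v : PiLp q (fun _ : Fin M => ℝ))‖

/-- Marginal probabilities `α_{0j} = P(Y_j = 1)` of a law `P` on `{0,1}^M`. -/
def marginal {M : ℕ} (P : Measure (Outcome M)) (j : Fin M) : ℝ :=
  P.real {y | y j = true}

/-- Standardized outcome `z_j(y, α)`. -/
def stdOutcome {M : ℕ} (α : Fin M → ℝ) (y : Outcome M) (j : Fin M) : ℝ :=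
  (bit (y j) - α j) / Real.sqrt (α j * (1 - α j))

/-- Bundles: sets of at least two components. There are `2^M - M - 1` of them. -/
abbrev Bundle (M : ℕ) : Type := {l : Finset (Fin M) // 2 ≤ l.card}

/-- The vector `W(α, y)`, indexed by bundles. -/
def bundleProd {M : ℕ} (α : Fin M → ℝ) (y : Outcome M) (l : Bundle M) : ℝ :=
  ∏ j ∈ l.1, stdOutcome α y j

/-- The vector `r_0` of correlation coefficients of a law `P` on `{0,1}^M`. -/
def corrCoef {M : ℕ} (P : Measure (Outcome M)) (l : Bundle M) : ℝ :=
  ∫ y, bundleProd (marginal P) y l ∂P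

/-- `1 + W(α, y)' r`. -/
def bahadurFactor {M : ℕ} (α : Fin M → ℝ) (r : Bundle M → ℝ) (y : Outcome M) : ℝ :=
  1 + ∑ l : Bundle M, bundleProd α y l * r l

/-- The setting without covariates: `Y_1, …, Y_N` are i.i.d. with law `P` on `{0,1}^M`; the vector
of correlation coefficients of `P` is `s`-sparse; `1 + W(α_0, y)' r_0` is at most `Lbar` for all `y`
and, with probability at least `1 - ε`, larger than `ξ` at all observations; the marginal
probabilities lie strictly between `η` and `1 - η`. -/
structure Setting {Ω : Type*} [MeasurableSpace Ω] (μ : Measure Ω) {N M : ℕ}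
    (Y : Fin N → Ω → Outcome M) (P : Measure (Outcome M))
    (s : ℕ) (Lbar ε ξ η : ℝ) : Prop where
  measurable : ∀ i, Measurable (Y i)
  indep : iIndepFun Y μ
  law : ∀ i, μ.map (Y i) = P
  sparse : (Function.support (corrCoef P)).ncard ≤ s
  bounded : ∀ y, bahadurFactor (marginal P) (corrCoef P) y ≤ Lbar
  lower : 1 - ε ≤ μ.real {ω | ∀ i, ξ < bahadurFactor (marginal P) (corrCoef P) (Y i ω)}
  eta_pos : 0 < η
  eta_lt_one : η < 1
  marginal_mem : ∀ j, η < marginal P j ∧ marginal P j < 1 - η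

/-- The sample-mean estimator `α̂` computed from the data `y_1, …, y_N`. -/
def alphaHat {N M : ℕ} (y : Fin N → Outcome M) (j : Fin M) : ℝ :=
  (1 / (N : ℝ)) * ∑ i, bit (y i j)

/-- `ŝ_j = √(α̂_j (1 - α̂_j))`. -/
def sHat {N M : ℕ} (y : Fin N → Outcome M) (j : Fin M) : ℝ :=
  Real.sqrt (alphaHat y j * (1 - alphaHat y j))

/-- The multiplier statistic
`max_j |N⁻¹ ∑_i ξ_i (y_{ij} - α̂_j) / √(α̂_j (1 - α̂_j))|` for data `y` and multipliers `ξ`.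
(A component with `α̂_j ∈ {0,1}` contributes `0`: all its numerators vanish.) -/
def bootStat {N M : ℕ} (y : Fin N → Outcome M) (ξ : Fin N → ℝ) : ℝ :=
  ⨆ j : Fin M, |(1 / (N : ℝ)) * ∑ i, ξ i * ((bit (y i j) - alphaHat y j) / sHat y j)|

/-- The critical value: the `(1 - δα)`-quantile of `bootStat y ξ` given the data `y`, where
`ξ_1, …, ξ_N` are i.i.d. standard normal. -/
def critVal {N M : ℕ} (δα : ℝ) (y : Fin N → Outcome M) : ℝ :=
  sInf {t : ℝ | 1 - δα ≤
    (Measure.pi (fun _ : Fin N => gaussianReal 0 1)).real {ξ | bootStat y ξ ≤ t}}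

/-- The confidence region `𝒜(α̂)`. -/
def confRegion {N M : ℕ} (δα : ℝ) (y : Fin N → Outcome M) : Set (Fin M → ℝ) :=
  Set.univ.pi fun j =>
    Set.Icc (alphaHat y j - critVal δα y * sHat y j) (alphaHat y j + critVal δα y * sHat y j)

end BinaryVec

end

/-! Norm bounds. Bahadur's expansion says that `P` has density `1 + W'r₀` with respect to the
product of its Bernoulli marginals, so the upper bound on this factor is a density bound `L`. A
product of Bernoulli laws satisfies Maurey's property (τ) for convex functions
(`bernoulli_convex_tau`), hence E exp(lg) · E exp(-lg) ≤ exp(2l²K²) for every convex `K`-Lipschitz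
`g`, with no dependence on the dimension. Passing to `P` costs a factor `L²`. Since that product is
the moment generating function of the symmetric variable g(Y) - g(Y'), the factor can be absorbed
into the exponent: the variance proxy becomes a constant times `L K²` (`symm_mgf_le`). Hoeffding's
lemma on the cube, of diameter √M, gives `M/4` in place of `L`, whence the minimum.

Averaging over some observations keeps a function convex and Lipschitz, so the bound for one
observation extends to `N` by successive conditioning (`prodSum_exp_le_of_bounded`). A Chernoff
bound for the Euclidean error, whose mean is at most its root mean square, gives the ℓ² claim.
Cauchy-Schwarz gives ℓ¹; Hoeffding for each component with a union bound gives ℓ^∞.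

Confidence region. `α̂` is the centre of its box, so only `α₀` matters. Given the data, the
multiplier sum is exactly Gaussian with the sample covariance, and the central limit theorem gives
the same limit to √N(α̂ - α₀). Uniformity in `P` comes from compactness: along a sequence of
counterexamples the second moments converge after extraction, and `eventually_coverage` contradicts
the failure. The limiting covariance may be singular, but its diagonal stays away from zero, so the
largest standardized component still has a continuous distribution function, and this is all that
the quantile comparison needs. -/

noncomputable section

namespace BinaryVec

/-! ### Expectations under finite product laws. -/

/-- The sum of `f` over all sequences, weighted by a product of weights. -/
def prodSum {n : ℕ} {α : Type*} [Fintype α] (w : Fin n → α → ℝ) (f : (Fin n → α) → ℝ) : ℝ :=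
  ∑ y, (∏ i, w i (y i)) * f y

lemma prodSum_zero {α : Type*} [Fintype α] (w : Fin 0 → α → ℝ) (f : (Fin 0 → α) → ℝ) :
    prodSum w f = f default := by
  simp [prodSum]

lemma prodSum_succ {n : ℕ} {α : Type*} [Fintype α] (w : Fin (n + 1) → α → ℝ)
    (f : (Fin (n + 1) → α) → ℝ) :
    prodSum w f = ∑ a, w 0 a * prodSum (fun i => w i.succ) (fun y => f (Fin.cons a y)) := by
  unfold prodSum
  rw [← (Fin.consEquiv (fun _ => α)).sum_comp, Fintype.sum_prod_type]
  refine Finset.sum_congr rfl fun a _ => ?_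
  rw [Finset.mul_sum]
  refine Finset.sum_congr rfl fun y _ => ?_
  simp [Fin.prod_univ_succ, Fin.consEquiv]
  ring

lemma prodSum_mono {n : ℕ} {α : Type*} [Fintype α] {w : Fin n → α → ℝ} (hw : ∀ i a, 0 ≤ w i a)
    {f g : (Fin n → α) → ℝ} (h : ∀ y, f y ≤ g y) : prodSum w f ≤ prodSum w g :=
  Finset.sum_le_sum fun y _ => mul_le_mul_of_nonneg_left (h y) (Finset.prod_nonneg fun i _ => hw i _)

lemma prodSum_nonneg {n : ℕ} {α : Type*} [Fintype α] {w : Fin n → α → ℝ} (hw : ∀ i a, 0 ≤ w i a)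
    {f : (Fin n → α) → ℝ} (h : ∀ y, 0 ≤ f y) : 0 ≤ prodSum w f :=
  Finset.sum_nonneg fun y _ => mul_nonneg (Finset.prod_nonneg fun i _ => hw i _) (h y)

lemma prodSum_mul_const {n : ℕ} {α : Type*} [Fintype α] (w : Fin n → α → ℝ)
    (f : (Fin n → α) → ℝ) (c : ℝ) : prodSum w (fun y => f y * c) = prodSum w f * c := by
  simp [prodSum, Finset.sum_mul, mul_assoc]

lemma prodSum_add {n : ℕ} {α : Type*} [Fintype α] (w : Fin n → α → ℝ)
    (f g : (Fin n → α) → ℝ) : prodSum w (fun y => f y + g y) = prodSum w f + prodSum w g := by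
  simp [prodSum, Finset.sum_add_distrib, mul_add]

lemma prodSum_const {n : ℕ} {α : Type*} [Fintype α] {w : Fin n → α → ℝ}
    (hw : ∀ i, ∑ a, w i a = 1) (c : ℝ) : prodSum w (fun _ => c) = c := by
  classical
  rw [prodSum, ← Finset.sum_mul, ← Fintype.piFinset_univ, ← Finset.prod_univ_sum]
  simp [hw]

lemma prodSum_pos {n : ℕ} {α : Type*} [Fintype α] {w : Fin n → α → ℝ} (hw : ∀ i a, 0 ≤ w i a)
    (hw1 : ∀ i, ∑ a, w i a = 1) {f : (Fin n → α) → ℝ} (h : ∀ y, 0 < f y) : 0 < prodSum w f := by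
  have h1 := prodSum_const hw1 1
  rw [prodSum] at h1
  obtain ⟨y, -, hy⟩ := Finset.exists_ne_zero_of_sum_ne_zero (by rw [h1]; norm_num)
  have hp : 0 ≤ ∏ i, w i (y i) := Finset.prod_nonneg fun i _ => hw i _
  refine Finset.sum_pos' (fun y _ => mul_nonneg (Finset.prod_nonneg fun i _ => hw i _) (h y).le)
    ⟨y, Finset.mem_univ _, mul_pos (lt_of_le_of_ne hp fun h => hy (by simp [← h])) (h y)⟩

/-- Log-convexity of sums of exponentials. -/
lemma prodSum_exp_convex_le {n : ℕ} {α : Type*} [Fintype α] {w : Fin n → α → ℝ}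
    (hw : ∀ i a, 0 ≤ w i a) (hw1 : ∀ i, ∑ a, w i a = 1) {f g h : (Fin n → α) → ℝ} {θ : ℝ}
    (h0 : 0 ≤ θ) (h1 : θ ≤ 1) (hh : ∀ y, h y ≤ (1 - θ) * f y + θ * g y) :
    prodSum w (fun y => Real.exp (h y)) ≤
      Real.exp ((1 - θ) * Real.log (prodSum w fun y => Real.exp (f y)) +
        θ * Real.log (prodSum w fun y => Real.exp (g y))) := by
  set a := Real.log (prodSum w fun y => Real.exp (f y)) with ha
  set b := Real.log (prodSum w fun y => Real.exp (g y)) with hb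
  have ea : Real.exp a = prodSum w fun y => Real.exp (f y) :=
    Real.exp_log (prodSum_pos hw hw1 fun y => Real.exp_pos _)
  have eb : Real.exp b = prodSum w fun y => Real.exp (g y) :=
    Real.exp_log (prodSum_pos hw hw1 fun y => Real.exp_pos _)
  -- Hölder's inequality in the form of convexity of `exp`, after normalizing exp(f) and exp(g) to
  -- have mean one.
  have key : ∀ y, Real.exp (h y) ≤ (Real.exp (f y) * ((1 - θ) * Real.exp (-a)) +
      Real.exp (g y) * (θ * Real.exp (-b))) * Real.exp ((1 - θ) * a + θ * b) := by
    intro y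
    have hc := convexOn_exp.2 (Set.mem_univ (f y - a)) (Set.mem_univ (g y - b))
      (sub_nonneg.2 h1) h0 (by ring)
    simp only [smul_eq_mul] at hc
    calc Real.exp (h y) ≤ Real.exp ((1 - θ) * (f y - a) + θ * (g y - b)) *
          Real.exp ((1 - θ) * a + θ * b) := by
            rw [← Real.exp_add]; exact Real.exp_le_exp.2 (by linarith [hh y])
      _ ≤ _ := by
        refine mul_le_mul_of_nonneg_right (hc.trans_eq ?_) (Real.exp_pos _).le
        rw [sub_eq_add_neg (f y), sub_eq_add_neg (g y), Real.exp_add, Real.exp_add]; ring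
  refine (prodSum_mono hw key).trans_eq ?_
  rw [prodSum_mul_const, prodSum_add, prodSum_mul_const, prodSum_mul_const, ← ea, ← eb,
    Real.exp_neg, Real.exp_neg]
  have := (Real.exp_pos a).ne'
  have := (Real.exp_pos b).ne'
  field_simp
  ring

/-! ### Property (τ) for products of Bernoulli laws. -/

/-- The numerical core of the two-point case. For small `a` the quadratic loss in `k` beats the
second-order terms of both exponentials; for large `a` the crude values 8/7 and 2/3 suffice. -/
lemma exp_add_exp_neg_le_two {k a : ℝ} (ha : 0 ≤ a) (h1 : a ≤ 1 / 2 → k ≤ a - 3 / 2 * a ^ 2)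
    (h2 : 1 / 2 ≤ a → k ≤ 1 / 8) : Real.exp k + Real.exp (-a) ≤ 2 := by
  rcases le_total a (1 / 2) with h | h
  · have hk := h1 h
    have e1 : Real.exp k ≤ 1 + (a - 3 / 2 * a ^ 2) + (a - 3 / 2 * a ^ 2) ^ 2 := by
      refine (Real.exp_le_exp.2 hk).trans ?_
      have := Real.abs_exp_sub_one_sub_id_le (x := a - 3 / 2 * a ^ 2)
        (by rw [abs_le]; constructor <;> nlinarith)
      have := (abs_le.1 this).2
      linarith
    have e2 : Real.exp (-a) ≤ 1 - a + a ^ 2 / 2 := by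
      have := Real.quadratic_le_exp_of_nonneg ha
      rw [Real.exp_neg, inv_le_iff_one_le_mul₀ (Real.exp_pos a)]
      have : 0 ≤ 1 - a + a ^ 2 / 2 := by nlinarith
      nlinarith [sq_nonneg (a ^ 2)]
    have e3 : (a - 3 / 2 * a ^ 2) ^ 2 ≤ a ^ 2 := by
      apply pow_le_pow_left₀ <;> nlinarith
    nlinarith
  · have hk := h2 h
    have e1 : Real.exp k ≤ 8 / 7 := by
      refine (Real.exp_le_exp.2 hk).trans ?_
      have := Real.add_one_le_exp (-(1 / 8) : ℝ)
      rw [Real.exp_neg] at this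
      have h3 := (le_inv_comm₀ (by norm_num) (Real.exp_pos _)).1 this
      norm_num at h3 ⊢
      linarith
    have e2 : Real.exp (-a) ≤ 2 / 3 := by
      have := Real.add_one_le_exp (1 / 2 : ℝ)
      have h4 : Real.exp (-a) ≤ Real.exp (-(1 / 2)) := Real.exp_le_exp.2 (by linarith)
      refine h4.trans ?_
      rw [Real.exp_neg, inv_le_comm₀ (Real.exp_pos _) (by norm_num)]
      norm_num at this ⊢
      linarith
    linarith

/-- The two-point case of the property `(τ)` for convex functions. -/
lemma two_point_le_one {p : ℝ} (hp0 : 0 ≤ p) (hp1 : p ≤ 1) {φ : ℝ → ℝ}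
    (hφ : ∀ θ, 0 ≤ θ → θ ≤ 1 → φ θ ≤ (1 - θ) * φ 0 + θ * φ 1) {a b : Bool → ℝ}
    (ha : ∀ c t, a c ≤ Real.exp (φ t + (bit c - t) ^ 2 / 8))
    (hb0 : ∀ c, 0 ≤ b c) (hb : ∀ c, b c ≤ Real.exp (-φ (bit c))) :
    (p * a true + (1 - p) * a false) * (p * b true + (1 - p) * b false) ≤ 1 := by
  have key : ∀ {q x y A B : ℝ}, 0 ≤ q → q ≤ 1 → y ≤ x → B ≤ Real.exp y →
      (∀ θ, 0 ≤ θ → θ ≤ 1 → A ≤ Real.exp ((1 - θ) * x + θ * y + θ ^ 2 / 8)) →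
      (q * A + (1 - q) * B) * (q * Real.exp (-x) + (1 - q) * Real.exp (-y)) ≤ 1 := by
    intro q x y A B hq0 hq1 hyx hB hA
    set d := x - y with hd
    have hd0 : 0 ≤ d := by linarith
    obtain ⟨k, hk, hk1, hk2⟩ : ∃ k, A ≤ Real.exp (y + k) ∧ (d ≤ 1 / 2 → k ≤ d - 3 / 2 * d ^ 2) ∧
        (1 / 2 ≤ d → k ≤ 1 / 8) := by
      rcases le_or_gt d (1 / 2) with h | h
      -- The choice θ = 2d turns x - θd + θ²/8 into y + d - 3d²/2 and is admissible up to d = 1/2;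
      -- beyond that θ = 1 is used.
      · refine ⟨d - 3 / 2 * d ^ 2, (hA (2 * d) (by linarith) (by linarith)).trans_eq ?_,
          fun _ => le_rfl, fun h' => ?_⟩
        · congr 1; rw [hd]; ring
        · have : d = 1 / 2 := le_antisymm h h'
          rw [this]; norm_num
      · exact ⟨1 / 8, (hA 1 zero_le_one le_rfl).trans_eq (by congr 1; ring), fun h' => by linarith,
          fun _ => le_rfl⟩
    have h2 := exp_add_exp_neg_le_two hd0 hk1 hk2
    have e1 : (q * A + (1 - q) * B) ≤ Real.exp y * (1 + q * (Real.exp k - 1)) := by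
      rw [Real.exp_add] at hk
      nlinarith
    have e2 : q * Real.exp (-x) + (1 - q) * Real.exp (-y) =
        Real.exp (-y) * (1 - q * (1 - Real.exp (-d))) := by
      have : Real.exp (-x) = Real.exp (-y) * Real.exp (-d) := by
        rw [← Real.exp_add]; congr 1; rw [hd]; ring
      rw [this]; ring
    have hv0 : 0 ≤ q * (1 - Real.exp (-d)) :=
      mul_nonneg hq0 (sub_nonneg.2 (Real.exp_le_one_iff.2 (by linarith)))
    have hv1 : q * (1 - Real.exp (-d)) ≤ 1 := by nlinarith [Real.exp_pos (-d)]
    have hu : q * (Real.exp k - 1) ≤ q * (1 - Real.exp (-d)) :=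
      mul_le_mul_of_nonneg_left (by linarith) hq0
    rw [e2]
    -- The factors exp(y) and exp(-y) cancel, leaving (1 + u)(1 - v) with u ≤ v, hence at most 1 -
    -- v².
    calc _ ≤ (Real.exp y * (1 + q * (Real.exp k - 1))) *
          (Real.exp (-y) * (1 - q * (1 - Real.exp (-d)))) :=
          mul_le_mul_of_nonneg_right e1 (mul_nonneg (Real.exp_pos _).le (by linarith))
      _ = (1 + q * (Real.exp k - 1)) * (1 - q * (1 - Real.exp (-d))) := by
          have : Real.exp y * Real.exp (-y) = 1 := by rw [← Real.exp_add]; simp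
          linear_combination
            ((1 + q * (Real.exp k - 1)) * (1 - q * (1 - Real.exp (-d)))) * this
      _ ≤ (1 + q * (1 - Real.exp (-d))) * (1 - q * (1 - Real.exp (-d))) :=
          mul_le_mul_of_nonneg_right (by linarith) (by linarith)
      _ ≤ 1 := by nlinarith [sq_nonneg (q * (1 - Real.exp (-d)))]
  have hat : ∀ c, a c ≤ Real.exp (φ (bit c)) := fun c => by simpa using ha c (bit c)
  have b1 : b true ≤ Real.exp (-φ 1) := by simpa [bit] using hb true
  have b0 : b false ≤ Real.exp (-φ 0) := by simpa [bit] using hb false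
  have a1 : a true ≤ Real.exp (φ 1) := by simpa [bit] using hat true
  have a0 : a false ≤ Real.exp (φ 0) := by simpa [bit] using hat false
  by_cases hneg : p * a true + (1 - p) * a false ≤ 0
  · refine (mul_nonpos_of_nonpos_of_nonneg hneg ?_).trans zero_le_one
    exact add_nonneg (mul_nonneg hp0 (hb0 _)) (mul_nonneg (by linarith) (hb0 _))
  have hB : p * b true + (1 - p) * b false ≤ p * Real.exp (-φ 1) + (1 - p) * Real.exp (-φ 0) :=
    add_le_add (mul_le_mul_of_nonneg_left b1 hp0) (mul_le_mul_of_nonneg_left b0 (by linarith))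
  refine (mul_le_mul_of_nonneg_left hB (not_le.1 hneg).le).trans ?_
  rcases le_total (φ 0) (φ 1) with h | h
  · refine key hp0 hp1 h a0 fun θ h0 h1 => ?_
    refine (ha true (1 - θ)).trans (Real.exp_le_exp.2 ?_)
    have := hφ (1 - θ) (by linarith) (by linarith)
    simp only [bit, if_true]
    nlinarith
  · have := key (q := 1 - p) (A := a false) (B := a true) (by linarith) (by linarith) h a1
      fun θ h0 h1 => by
        refine (ha false θ).trans (Real.exp_le_exp.2 ?_)
        have := hφ θ h0 h1
        simp only [bit]
        norm_num
        nlinarith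
    calc _ = _ := ?_
      _ ≤ 1 := this
    ring

/-- Weights of a Bernoulli law. -/
def bernWeight (p : ℝ) (b : Bool) : ℝ := if b then p else 1 - p

lemma bernWeight_nonneg {p : ℝ} (h0 : 0 ≤ p) (h1 : p ≤ 1) (b : Bool) : 0 ≤ bernWeight p b := by
  cases b <;> simp [bernWeight, h0, h1]

lemma sum_bernWeight (p : ℝ) : ∑ b, bernWeight p b = 1 := by simp [bernWeight]

/-- Maurey's property `(τ)` for convex functions and a product of Bernoulli laws. -/
theorem bernoulli_convex_tau {n : ℕ} (p : Fin n → ℝ) (hp : ∀ i, 0 ≤ p i ∧ p i ≤ 1)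
    {f : (Fin n → ℝ) → ℝ} (hf : ConvexOn ℝ Set.univ f) {c : ℝ} (hc : ∀ z, c ≤ f z)
    {h : (Fin n → Bool) → ℝ} (hh : ∀ y z, h y ≤ f z + (∑ j, (bit (y j) - z j) ^ 2) / 8) :
    prodSum (fun i => bernWeight (p i)) (fun y => Real.exp (h y)) *
      prodSum (fun i => bernWeight (p i)) (fun y => Real.exp (-f fun j => bit (y j))) ≤ 1 := by
  induction n with
  | zero =>
    rw [prodSum_zero, prodSum_zero, ← Real.exp_add, Real.exp_le_one_iff]
    have := hh default (fun j => bit ((default : Fin 0 → Bool) j))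
    simp only [Finset.univ_eq_empty, Finset.sum_empty, zero_div, add_zero] at this
    rw [← sub_eq_add_neg, sub_nonpos]
    convert this
  | succ n ih =>
    have hw : ∀ (i : Fin n) a, 0 ≤ bernWeight (p i.succ) a := fun i a =>
      bernWeight_nonneg (hp _).1 (hp _).2 a
    have hw1 : ∀ i : Fin n, ∑ a, bernWeight (p i.succ) a = 1 := fun i => sum_bernWeight _
    -- Infimal convolution in all coordinates but the first, which is frozen at a real `t`. The
    -- lower bound `c` on `f` keeps the infimum finite.
    set k : ℝ → (Fin n → Bool) → ℝ := fun t y =>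
      ⨅ z : Fin n → ℝ, (f (Fin.cons t z) + (∑ j, (bit (y j) - z j) ^ 2) / 8) with hk
    have hbdd : ∀ t (y : Fin n → Bool), BddBelow (Set.range fun z : Fin n → ℝ =>
        (f (Fin.cons t z) + (∑ j, (bit (y j) - z j) ^ 2) / 8)) := by
      intro t y
      refine ⟨c, ?_⟩
      rintro _ ⟨z, rfl⟩
      have := hc (Fin.cons t z)
      have h2 : 0 ≤ ∑ j, (bit (y j) - z j) ^ 2 := Finset.sum_nonneg fun j _ => sq_nonneg _
      dsimp only
      linarith
    have hkle : ∀ t y z, k t y ≤ f (Fin.cons t z) + (∑ j, (bit (y j) - z j) ^ 2) / 8 :=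
      fun t y z => ciInf_le (hbdd t y) z
    have hcomb : ∀ (α β s t : ℝ) (x z : Fin n → ℝ), (Fin.cons (α * s + β * t) (α • x + β • z) :
        Fin (n + 1) → ℝ) = α • (Fin.cons s x : Fin (n + 1) → ℝ) + β • (Fin.cons t z) := by
      intro α β s t x z
      ext j
      refine Fin.cases ?_ (fun j => ?_) j <;> simp
    have hconv : ∀ t, ConvexOn ℝ Set.univ fun z : Fin n → ℝ => f (Fin.cons t z) := by
      intro t
      refine ⟨convex_univ, fun x _ z _ α β hα hβ hαβ => ?_⟩
      have := hf.2 (Set.mem_univ (Fin.cons t x)) (Set.mem_univ (Fin.cons t z)) hα hβ hαβ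
      rw [← hcomb, ← add_mul, hαβ, one_mul] at this
      exact this
    have hih := fun t => ih (fun i => p i.succ) (fun i => hp _) (hconv t) (fun z => hc _) (hkle t)
    set S : ℝ → ℝ := fun t => prodSum (fun i => bernWeight (p i.succ)) fun y => Real.exp (k t y)
      with hS
    have hSpos : ∀ t, 0 < S t := fun t => prodSum_pos hw hw1 fun y => Real.exp_pos _
    set φ : ℝ → ℝ := fun t => Real.log (S t) with hφ
    -- Partial minimization of a jointly convex function is convex in `t`, and log E exp preserves
    -- convexity; the chord inequality on [0, 1] is what the two-point case asks for.
    have hφc : ∀ θ, 0 ≤ θ → θ ≤ 1 → φ θ ≤ (1 - θ) * φ 0 + θ * φ 1 := by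
      intro θ h0 h1
      refine (Real.log_le_iff_le_exp (hSpos θ)).2 (prodSum_exp_convex_le hw hw1 h0 h1 fun y => ?_)
      have h1' : 0 ≤ 1 - θ := by linarith
      simp only [hk]
      rw [Real.mul_iInf_of_nonneg h1', Real.mul_iInf_of_nonneg h0]
      refine le_ciInf_add_ciInf fun x z => ?_
      refine (ciInf_le (hbdd θ y) ((1 - θ) • x + θ • z)).trans ?_
      have e := hf.2 (Set.mem_univ (Fin.cons 0 x)) (Set.mem_univ (Fin.cons 1 z)) h1' h0 (by ring)
      rw [← hcomb] at e
      simp only [mul_zero, zero_add, mul_one, smul_eq_mul] at e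
      have e2 : ∑ j, (bit (y j) - ((1 - θ) • x + θ • z) j) ^ 2 ≤
          (1 - θ) * ∑ j, (bit (y j) - x j) ^ 2 + θ * ∑ j, (bit (y j) - z j) ^ 2 := by
        rw [Finset.mul_sum, Finset.mul_sum, ← Finset.sum_add_distrib]
        refine Finset.sum_le_sum fun j _ => ?_
        simp only [Pi.add_apply, Pi.smul_apply, smul_eq_mul]
        nlinarith [mul_nonneg (mul_nonneg h0 h1') (sq_nonneg (x j - z j))]
      linarith
    rw [prodSum_succ, prodSum_succ]
    simp only [Fintype.sum_bool, bernWeight, if_true]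
    simp only [Bool.false_eq_true, if_false]
    refine two_point_le_one (hp 0).1 (hp 0).2 hφc
      (a := fun b => prodSum (fun i : Fin n => bernWeight (p i.succ))
        fun y => Real.exp (h (Fin.cons b y)))
      (b := fun b => prodSum (fun i : Fin n => bernWeight (p i.succ))
        fun y => Real.exp (-f fun j => bit ((Fin.cons b y : Fin (n + 1) → Bool) j))) ?_ ?_ ?_
    · intro b t
      rw [Real.exp_add, Real.exp_log (hSpos t), hS, ← prodSum_mul_const]
      refine prodSum_mono hw fun y => ?_
      rw [← Real.exp_add]
      refine Real.exp_le_exp.2 ?_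
      rw [← sub_le_iff_le_add]
      refine le_ciInf fun z => ?_
      have := hh (Fin.cons b y) (Fin.cons t z)
      rw [Fin.sum_univ_succ] at this
      simp only [Fin.cons_zero, Fin.cons_succ] at this
      linarith
    · exact fun b => prodSum_nonneg hw fun y => (Real.exp_pos _).le
    · intro b
      have := hih (bit b)
      rw [Real.exp_neg, Real.exp_log (hSpos _), ← one_div, le_div_iff₀ (hSpos _), mul_comm]
      refine le_trans (le_of_eq ?_) this
      congr 2
      ext y
      congr 3
      ext j
      refine Fin.cases ?_ (fun j => ?_) j <;> simp

/-- Two-sided exponential bound for convex functions that are Lipschitz for the Euclidean norm. -/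
lemma bernoulli_exp_mul_exp_neg_le {n : ℕ} (p : Fin n → ℝ) (hp : ∀ i, 0 ≤ p i ∧ p i ≤ 1)
    {g : (Fin n → ℝ) → ℝ} (hg : ConvexOn ℝ Set.univ g) (hg0 : ∀ z, 0 ≤ g z) {K : ℝ}
    (hK : ∀ x z, g x - g z ≤ K * √(∑ j, (x j - z j) ^ 2)) {l : ℝ} (hl : 0 ≤ l) :
    prodSum (fun i => bernWeight (p i)) (fun y => Real.exp (l * g fun j => bit (y j))) *
      prodSum (fun i => bernWeight (p i)) (fun y => Real.exp (-(l * g fun j => bit (y j)))) ≤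
      Real.exp (2 * l ^ 2 * K ^ 2) := by
  have := bernoulli_convex_tau p hp (f := fun z => l * g z) (hg.smul hl) (c := 0)
    (fun z => mul_nonneg hl (hg0 z))
    (h := fun y => l * (g fun j => bit (y j)) - 2 * l ^ 2 * K ^ 2) fun y z => by
      have h1 := mul_le_mul_of_nonneg_left (hK (fun j => bit (y j)) z) hl
      have h2 := Real.sq_sqrt (Finset.sum_nonneg fun j (_ : j ∈ Finset.univ) =>
        sq_nonneg (bit (y j) - z j))
      -- Young's inequality lKr ≤ 2l²K² + r²/8, with `r` the Euclidean distance.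
      nlinarith [sq_nonneg (4 * l * K - √(∑ j, (bit (y j) - z j) ^ 2))]
  simp only [sub_eq_add_neg, Real.exp_add] at this
  rw [prodSum_mul_const, mul_right_comm, Real.exp_neg, ← div_eq_mul_inv,
    div_le_one (Real.exp_pos _)] at this
  exact this

/-! ### Subgaussian bounds under a bounded density. -/

/-- Termwise comparison of power series: every nonconstant term has degree at least two, so it gains
at least θ². For a symmetric variable this brings the moment generating function down to 1 + O(l²)
near zero. -/
lemma cosh_mul_le {θ : ℝ} (h0 : 0 ≤ θ) (h1 : θ ≤ 1) (x : ℝ) :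
    Real.cosh (θ * x) ≤ 1 - θ ^ 2 + θ ^ 2 * Real.cosh x := by
  have e1 := Real.hasSum_cosh (θ * x)
  have e2 := (hasSum_ite_eq 0 (1 - θ ^ 2)).add ((Real.hasSum_cosh x).mul_left (θ ^ 2))
  refine hasSum_le (fun n => ?_) e1 e2
  rcases n with _ | n
  · simp
  · have h3 : (θ * x) ^ (2 * (n + 1)) ≤ θ ^ 2 * x ^ (2 * (n + 1)) := by
      rw [mul_pow]
      refine mul_le_mul_of_nonneg_right (pow_le_pow_of_le_one h0 h1 (by lia)) ?_
      rw [pow_mul]; positivity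
    simp only [Nat.add_eq_zero_iff, one_ne_zero, and_false, if_false, zero_add]
    rw [← mul_div_assoc]
    exact div_le_div_of_nonneg_right h3 (by positivity)

/-- A symmetric variable whose moment generating function is at most `L² exp(2 l² K²)` is
subgaussian, without the leading constant. -/
lemma symm_mgf_le {β : Type*} [Fintype β] {w Z : β → ℝ} (hw : ∀ b, 0 ≤ w b) (hw1 : ∑ b, w b = 1)
    (hsymm : ∀ l, ∑ b, w b * Real.exp (-l * Z b) = ∑ b, w b * Real.exp (l * Z b))
    {L K : ℝ} (hL : 1 ≤ L) (hK : 0 < K)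
    (hmgf : ∀ l, 0 ≤ l → ∑ b, w b * Real.exp (l * Z b) ≤ L ^ 2 * Real.exp (2 * l ^ 2 * K ^ 2))
    {l : ℝ} (hl : 0 ≤ l) :
    ∑ b, w b * Real.exp (l * Z b) ≤ Real.exp (Real.exp 4 * L * K ^ 2 * l ^ 2) := by
  have hL0 : 0 < L := by linarith
  set φ : ℝ → ℝ := fun l => ∑ b, w b * Real.exp (l * Z b) with hφ
  have hφ0 : ∀ l, 0 ≤ φ l := fun l =>
    Finset.sum_nonneg fun b _ => mul_nonneg (hw b) (Real.exp_pos _).le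
  have step : ∀ l, 0 ≤ l → φ l ≤ Real.exp (2 + 2 * L * l ^ 2 * K ^ 2) := by
    intro l hl
    -- Jensen's inequality with exponent `L`: taking the `L`-th root of the bound at `L * l` reduces
    -- `L²` to at most exp(2).
    have h1 : φ l ^ L ≤ φ (L * l) := by
      have := Real.rpow_arith_mean_le_arith_mean_rpow Finset.univ w
        (fun b => Real.exp (l * Z b)) (fun b _ => hw b) hw1 (fun b _ => (Real.exp_pos _).le) hL
      refine this.trans_eq (Finset.sum_congr rfl fun b _ => ?_)
      rw [← Real.exp_mul]
      congr 2; ring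
    have h2 : φ (L * l) ≤ Real.exp (2 + 2 * L * l ^ 2 * K ^ 2) ^ L := by
      refine (hmgf _ (by positivity)).trans ?_
      have h3 : L ≤ Real.exp L := by linarith [Real.add_one_le_exp L]
      have h4 : L ^ 2 ≤ Real.exp (2 * L) := by
        rw [two_mul, Real.exp_add, sq]
        exact mul_le_mul h3 h3 hL0.le (Real.exp_pos _).le
      rw [← Real.exp_mul]
      refine (mul_le_mul_of_nonneg_right h4 (Real.exp_pos _).le).trans_eq ?_
      rw [← Real.exp_add]
      congr 1; ring
    exact (Real.rpow_le_rpow_iff (hφ0 l) (Real.exp_pos _).le hL0).1 (h1.trans h2)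
  have hcosh : ∀ l, φ l = ∑ b, w b * Real.cosh (l * Z b) := by
    intro l
    have := hsymm l
    have h2 : 2 * ∑ b, w b * Real.cosh (l * Z b) = φ l + φ l := by
      nth_rewrite 2 [hφ]
      dsimp only
      rw [← this, hφ, ← Finset.sum_add_distrib, Finset.mul_sum]
      refine Finset.sum_congr rfl fun b _ => ?_
      rw [Real.cosh_eq, neg_mul]; ring
    linarith
  have he : (4 : ℝ) ≤ Real.exp 4 := by linarith [Real.add_one_le_exp (4 : ℝ)]
  rcases le_total (L * K ^ 2 * l ^ 2) 1 with h | h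
  · set θ := √(L * K ^ 2 * l ^ 2) with hθ
    have hθ0 : 0 ≤ θ := Real.sqrt_nonneg _
    have hθ1 : θ ≤ 1 := Real.sqrt_le_one.2 h
    have hθ2 : θ ^ 2 = L * K ^ 2 * l ^ 2 := Real.sq_sqrt (by positivity)
    -- At this scale the bound of `step` equals exp(2 + 2); smaller `l` are reached by interpolating
    -- between 0 and `l₀`, and for larger `l` the constant 2 is absorbed by the quadratic term.
    set l₀ := (√L * K)⁻¹ with hl₀
    have hLK : 0 < √L * K := mul_pos (Real.sqrt_pos.2 hL0) hK
    have hll : l = θ * l₀ := by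
      rw [hl₀, eq_mul_inv_iff_mul_eq₀ hLK.ne', hθ]
      rw [show L * K ^ 2 * l ^ 2 = L * (K * l) ^ 2 by ring, Real.sqrt_mul hL0.le,
        Real.sqrt_sq (by positivity)]
      ring
    have hb : φ l₀ ≤ Real.exp 4 := by
      refine (step l₀ (by positivity)).trans_eq ?_
      congr 1
      rw [hl₀, inv_pow, mul_pow, Real.sq_sqrt hL0.le]
      field_simp
      norm_num
    have : φ l ≤ 1 - θ ^ 2 + θ ^ 2 * φ l₀ := by
      rw [hcosh l, hcosh l₀, Finset.mul_sum]
      have e1 : 1 - θ ^ 2 = ∑ b, w b * (1 - θ ^ 2) := by rw [← Finset.sum_mul, hw1, one_mul]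
      rw [e1, ← Finset.sum_add_distrib]
      refine Finset.sum_le_sum fun b _ => ?_
      have := mul_le_mul_of_nonneg_left (cosh_mul_le hθ0 hθ1 (l₀ * Z b)) (hw b)
      rw [hll, mul_assoc]
      linarith
    calc φ l ≤ Real.exp 4 * L * K ^ 2 * l ^ 2 + 1 := by nlinarith
      _ ≤ _ := Real.add_one_le_exp _
  · refine (step l hl).trans (Real.exp_le_exp.2 ?_)
    nlinarith

/-- Passing from a product law to a law with bounded density: subgaussian bound. -/
lemma centered_mgf_le_of_density {α : Type*} [Fintype α] {p q : α → ℝ} (hp : ∀ a, 0 ≤ p a)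
    (hp1 : ∑ a, p a = 1) {L K : ℝ} (hL : 1 ≤ L) (hK : 0 < K) (hpq : ∀ a, p a ≤ L * q a)
    {g : α → ℝ}
    (hg : ∀ l, 0 ≤ l → (∑ a, q a * Real.exp (l * g a)) * (∑ a, q a * Real.exp (-(l * g a))) ≤
      Real.exp (2 * l ^ 2 * K ^ 2)) {l : ℝ} (hl : 0 ≤ l) :
    ∑ a, p a * Real.exp (l * (g a - ∑ b, p b * g b)) ≤
      Real.exp (Real.exp 4 * L * K ^ 2 * l ^ 2) := by
  have hL0 : 0 < L := by linarith
  have hprod : ∀ l : ℝ, ∑ b : α × α, p b.1 * p b.2 * Real.exp (l * (g b.1 - g b.2)) =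
      (∑ a, p a * Real.exp (l * g a)) * (∑ a, p a * Real.exp (-(l * g a))) := by
    intro l
    rw [Fintype.sum_prod_type, Finset.sum_mul_sum]
    refine Finset.sum_congr rfl fun a _ => Finset.sum_congr rfl fun b _ => ?_
    rw [mul_sub, sub_eq_add_neg, Real.exp_add]; ring
  have hle : ∀ h : α → ℝ, ∑ a, p a * Real.exp (h a) ≤ L * ∑ a, q a * Real.exp (h a) := by
    intro h
    rw [Finset.mul_sum]
    refine Finset.sum_le_sum fun a _ => ?_
    rw [← mul_assoc]
    exact mul_le_mul_of_nonneg_right (hpq a) (Real.exp_pos _).le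
  have hpos : ∀ h : α → ℝ, 0 ≤ ∑ a, p a * Real.exp (h a) := fun h =>
    Finset.sum_nonneg fun a _ => mul_nonneg (hp a) (Real.exp_pos _).le
  have main := symm_mgf_le (β := α × α) (w := fun b => p b.1 * p b.2)
    (Z := fun b => g b.1 - g b.2) (fun b => mul_nonneg (hp _) (hp _))
    (by rw [Fintype.sum_prod_type, ← Finset.sum_mul_sum, hp1, one_mul])
    (fun l => by
      rw [hprod, hprod, mul_comm]
      simp)
    hL hK (fun l hl => by
      rw [hprod]
      refine (mul_le_mul (hle _) (hle _) (hpos _) ((hpos _).trans (hle _))).trans ?_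
      have := mul_le_mul_of_nonneg_left (hg l hl) (sq_nonneg L)
      linarith) hl
  refine le_trans ?_ main
  rw [hprod]
  have e1 : ∀ a, p a * Real.exp (l * (g a - ∑ b, p b * g b)) =
      p a * Real.exp (l * g a) * Real.exp (∑ b, p b * (-(l * g b))) := by
    intro a
    rw [mul_assoc, ← Real.exp_add, mul_sub, sub_eq_add_neg]
    congr 3
    rw [Finset.mul_sum, ← Finset.sum_neg_distrib]
    exact Finset.sum_congr rfl fun b _ => by ring
  simp only [e1]
  rw [← Finset.sum_mul]
  refine mul_le_mul_of_nonneg_left ?_ (hpos _)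
  -- Jensen's inequality in the independent copy replaces it by its mean, turning symmetrization
  -- into centering.
  have := convexOn_exp.map_sum_le (t := Finset.univ) (w := p) (p := fun b => -(l * g b))
    (fun b _ => hp b) hp1 (fun b _ => Set.mem_univ _)
  simpa [smul_eq_mul] using this

/-! ### Bahadur's representation. -/

section Bahadur

variable {M : ℕ} {α : Fin M → ℝ}

/-- The constant 1 and the standardized outcome form an orthonormal basis of L² of a Bernoulli law,
so their reproducing kernel times the weight is a Kronecker delta. -/
lemma bernWeight_mul_one_add_stdOutcome {j : Fin M} (h0 : 0 < α j) (h1 : α j < 1)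
    (y y' : Outcome M) :
    bernWeight (α j) (y j) * (1 + stdOutcome α y j * stdOutcome α y' j) =
      if y' j = y j then 1 else 0 := by
  have hs : √(α j * (1 - α j)) * √(α j * (1 - α j)) = α j * (1 - α j) :=
    Real.mul_self_sqrt (mul_nonneg h0.le (by linarith))
  have h2 : 1 - α j ≠ 0 := by linarith
  rw [stdOutcome, stdOutcome, div_mul_div_comm, hs]
  cases y j <;> cases y' j <;> simp [bit, bernWeight] <;> field_simp <;>
    simp

/-- The expansion over all subsets, sorted by size. Once `v` is integrated, the empty set gives 1,
singletons vanish by centering, and bundles give the correlation coefficients. -/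
lemma prod_one_add_eq_bundles (u v : Fin M → ℝ) :
    ∏ j, (1 + u j * v j) = 1 + ∑ j, u j * v j +
      ∑ l : Bundle M, (∏ j ∈ l.1, u j) * ∏ j ∈ l.1, v j := by
  classical
  rw [Finset.prod_one_add, Finset.powerset_univ,
    ← Fintype.sum_subtype_add_sum_subtype (fun l : Finset (Fin M) => 2 ≤ l.card), add_comm]
  congr 1
  · have e : ∑ l : {l : Finset (Fin M) // ¬ 2 ≤ l.card}, ∏ j ∈ l.1, u j * v j =
        ∑ o : Option (Fin M), o.elim 1 fun j => u j * v j := by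
      refine (Fintype.sum_bijective (fun o : Option (Fin M) =>
        (⟨o.elim ∅ fun j => {j}, by cases o <;> simp⟩ : {l : Finset (Fin M) // ¬ 2 ≤ l.card}))
        ⟨?_, ?_⟩ _ _ ?_).symm
      · intro a b hab
        cases a <;> cases b <;> simp_all
      · rintro ⟨l, hl⟩
        rcases Nat.lt_succ_iff_lt_or_eq.1 (not_le.1 hl) with h | h
        · exact ⟨none, by
            simp only [Nat.lt_one_iff, Finset.card_eq_zero] at h
            subst h; rfl⟩
        · obtain ⟨j, rfl⟩ := Finset.card_eq_one.1 h
          exact ⟨some j, rfl⟩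
      · intro o
        cases o <;> simp
    rw [e, Fintype.sum_option]
    rfl
  · exact Finset.sum_congr rfl fun l _ => Finset.prod_mul_distrib

lemma integral_bit (P : Measure (Outcome M)) [IsProbabilityMeasure P] (j : Fin M) :
    ∫ y, bit (y j) ∂P = marginal P j := by
  have : (fun y : Outcome M => bit (y j)) = Set.indicator {y | y j = true} 1 := by
    ext y
    simp [bit, Set.indicator_apply]
  rw [this, integral_indicator_one (Set.toFinite _).measurableSet, marginal]

lemma integral_stdOutcome (P : Measure (Outcome M)) [IsProbabilityMeasure P] (j : Fin M) :
    ∫ y, stdOutcome (marginal P) y j ∂P = 0 := by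
  simp only [stdOutcome]
  rw [integral_div, integral_sub .of_finite .of_finite, integral_bit]
  simp

/-- **Bahadur's representation** of a law on `{0,1}^M`. -/
theorem real_singleton_eq_bahadur (P : Measure (Outcome M)) [IsProbabilityMeasure P]
    (hα : ∀ j, 0 < marginal P j ∧ marginal P j < 1) (y : Outcome M) :
    P.real {y} = (∏ j, bernWeight (marginal P j) (y j)) *
      bahadurFactor (marginal P) (corrCoef P) y := by
  have h1 : P.real {y} = ∫ y', (∏ j, bernWeight (marginal P j) (y j)) *
      ∏ j, (1 + stdOutcome (marginal P) y j * stdOutcome (marginal P) y' j) ∂P := by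
    rw [← integral_indicator_one (Set.toFinite _).measurableSet]
    congr 1
    ext y'
    rw [← Finset.prod_mul_distrib, Finset.prod_congr rfl fun j _ =>
      bernWeight_mul_one_add_stdOutcome (hα j).1 (hα j).2 y y']
    by_cases h : y' = y
    · simp [h]
    · obtain ⟨j, hj⟩ := Function.ne_iff.1 h
      rw [Set.indicator_of_notMem (by simpa using h)]
      exact (Finset.prod_eq_zero (Finset.mem_univ j) (by simp [hj])).symm
  rw [h1, integral_const_mul]
  congr 1
  simp only [prod_one_add_eq_bundles]
  rw [integral_add .of_finite .of_finite, integral_add .of_finite .of_finite,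
    integral_finsetSum _ fun _ _ => .of_finite, integral_finsetSum _ fun _ _ => .of_finite]
  simp only [integral_const_mul, integral_stdOutcome]
  simp [bahadurFactor, corrCoef, bundleProd]

end Bahadur

/-! ### Deviations of convex Lipschitz functions of sums of observations. -/

/-- Nonnegative convex functions that are `K`-Lipschitz for the Euclidean norm. -/
structure ConvexLip {n : ℕ} (K : ℝ) (F : (Fin n → ℝ) → ℝ) : Prop where
  convex : ConvexOn ℝ Set.univ F
  nonneg : ∀ z, 0 ≤ F z
  lip : ∀ x z, F x - F z ≤ K * √(∑ j, (x j - z j) ^ 2)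

lemma ConvexLip.translate {n : ℕ} {K : ℝ} {F : (Fin n → ℝ) → ℝ} (hF : ConvexLip K F)
    (v : Fin n → ℝ) : ConvexLip K fun x => F (v + x) where
  convex := by
    refine ⟨convex_univ, fun x _ z _ a b ha hb hab => ?_⟩
    have := hF.convex.2 (Set.mem_univ (v + x)) (Set.mem_univ (v + z)) ha hb hab
    refine le_trans (le_of_eq ?_) this
    rw [smul_add, smul_add, add_add_add_comm, ← add_smul, hab, one_smul]
  nonneg z := hF.nonneg _
  lip x z := by simpa using hF.lip (v + x) (v + z)

/-- Stability under averaging is what makes the induction on the number of observations close with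
an unchanged constant `K`. -/
lemma ConvexLip.prodSum {n N : ℕ} {α : Type*} [Fintype α] {w : Fin N → α → ℝ}
    (hw : ∀ i a, 0 ≤ w i a) (hw1 : ∀ i, ∑ a, w i a = 1) {K : ℝ}
    {F : (Fin N → α) → (Fin n → ℝ) → ℝ} (hF : ∀ y, ConvexLip K (F y)) :
    ConvexLip K fun x => prodSum w fun y => F y x where
  convex := by
    refine ⟨convex_univ, fun x hx z hz a b ha hb hab => ?_⟩
    refine (prodSum_mono hw fun y => (hF y).convex.2 hx hz ha hb hab).trans_eq ?_
    simp only [smul_eq_mul, mul_comm a, mul_comm b]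
    rw [prodSum_add, prodSum_mul_const, prodSum_mul_const]
  nonneg z := prodSum_nonneg hw fun y => (hF y).nonneg z
  lip x z := by
    rw [sub_le_iff_le_add, ← prodSum_const hw1 (K * √(∑ j, (x j - z j) ^ 2)), ← prodSum_add]
    exact prodSum_mono hw fun y => sub_le_iff_le_add.1 ((hF y).lip x z)

variable {M : ℕ}

/-- The real vector coded by an outcome. -/
def bits (y : Outcome M) : Fin M → ℝ := fun j => bit (y j)

lemma bit_mem (b : Bool) : bit b ∈ Set.Icc (0 : ℝ) 1 := by cases b <;> simp [bit]

lemma bit_sub_sq_le (a b : Bool) : (bit a - bit b) ^ 2 ≤ 1 := by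
  cases a <;> cases b <;> norm_num [bit]

lemma sum_real_singleton (P : Measure (Outcome M)) [IsProbabilityMeasure P] :
    ∑ y, P.real {y} = 1 := by
  simp

lemma integral_pi_eq_prodSum {N : ℕ} (P : Measure (Outcome M)) [IsProbabilityMeasure P]
    (G : (Fin N → Outcome M) → ℝ) :
    ∫ y, G y ∂(Measure.pi fun _ : Fin N => P) =
      prodSum (fun _ : Fin N => fun a => P.real {a}) G := by
  rw [integral_fintype .of_finite, BinaryVec.prodSum]
  refine Finset.sum_congr rfl fun y _ => ?_
  rw [Measure.real, Measure.pi_singleton, ENNReal.toReal_prod, smul_eq_mul]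
  rfl

lemma real_singleton_le_of_bounded (P : Measure (Outcome M)) [IsProbabilityMeasure P]
    (hα : ∀ j, 0 < marginal P j ∧ marginal P j < 1) {L : ℝ}
    (hL : ∀ y, bahadurFactor (marginal P) (corrCoef P) y ≤ L) (y : Outcome M) :
    P.real {y} ≤ L * ∏ j, bernWeight (marginal P j) (y j) := by
  rw [real_singleton_eq_bahadur P hα, mul_comm]
  exact mul_le_mul_of_nonneg_right (hL y) (Finset.prod_nonneg fun j _ =>
    bernWeight_nonneg (hα j).1.le (hα j).2.le _)

lemma one_le_of_bahadurFactor_le (P : Measure (Outcome M)) [IsProbabilityMeasure P]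
    (hα : ∀ j, 0 < marginal P j ∧ marginal P j < 1) {L : ℝ}
    (hL : ∀ y, bahadurFactor (marginal P) (corrCoef P) y ≤ L) : 1 ≤ L := by
  rw [← sum_real_singleton P]
  refine (Finset.sum_le_sum fun y _ => real_singleton_le_of_bounded P hα hL y).trans_eq ?_
  have := prodSum_const (w := fun j => bernWeight (marginal P j)) (fun j => sum_bernWeight _) 1
  rw [BinaryVec.prodSum] at this
  simp only [mul_one] at this
  rw [← Finset.mul_sum, this, mul_one]

/-- The cube has Euclidean diameter √M, so `F` oscillates by at most K√M on it. No density bound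
enters. -/
lemma mgf_le_hoeffding (P : Measure (Outcome M)) [IsProbabilityMeasure P] {K : ℝ} (hK : 0 ≤ K)
    {F : (Fin M → ℝ) → ℝ} (hF : ConvexLip K F) (l : ℝ) :
    ∑ a, P.real {a} * Real.exp (l * (F (bits a) - ∑ b, P.real {b} * F (bits b))) ≤
      Real.exp (K ^ 2 * (M / 4) * l ^ 2 / 2) := by
  obtain ⟨y₀, hy₀⟩ := Finite.exists_min fun y : Outcome M => F (bits y)
  have hle : ∀ y : Outcome M, F (bits y) ≤ F (bits y₀) + K * √M := by
    intro y
    have h1 := hF.lip (bits y) (bits y₀)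
    have h2 : √(∑ j, (bits y j - bits y₀ j) ^ 2) ≤ √M := by
      refine Real.sqrt_le_sqrt ?_
      refine (Finset.sum_le_sum fun j _ => bit_sub_sq_le (y j) (y₀ j)).trans_eq ?_
      simp
    have := mul_le_mul_of_nonneg_left h2 hK
    linarith
  have h := (hasSubgaussianMGF_of_mem_Icc (μ := P) (X := fun y => F (bits y))
    (a := F (bits y₀)) (b := F (bits y₀) + K * √M) (measurable_of_finite _).aemeasurable
    (ae_of_all _ fun y => ⟨hy₀ y, hle y⟩)).mgf_le l
  rw [mgf, integral_fintype .of_finite, integral_fintype .of_finite] at h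
  simp only [smul_eq_mul, add_sub_cancel_left] at h
  refine h.trans_eq ?_
  congr 2
  push_cast
  rw [Real.norm_of_nonneg (by positivity), div_pow, mul_pow, Real.sq_sqrt (Nat.cast_nonneg _)]
  ring

/-- Subgaussian bound for a convex Lipschitz function of one observation. -/
lemma mgf_le_of_bounded (P : Measure (Outcome M)) [IsProbabilityMeasure P]
    (hα : ∀ j, 0 < marginal P j ∧ marginal P j < 1) {L : ℝ}
    (hL : ∀ y, bahadurFactor (marginal P) (corrCoef P) y ≤ L) {K : ℝ} (hK : 0 < K)
    {F : (Fin M → ℝ) → ℝ} (hF : ConvexLip K F) {l : ℝ} (hl : 0 ≤ l) :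
    ∑ a, P.real {a} * Real.exp (l * F (bits a)) ≤
      Real.exp (Real.exp 4 * min L (M / 4) * K ^ 2 * l ^ 2) *
        Real.exp (l * ∑ b, P.real {b} * F (bits b)) := by
  have h1 : ∑ a, P.real {a} * Real.exp (l * (F (bits a) - ∑ b, P.real {b} * F (bits b))) ≤
      Real.exp (Real.exp 4 * min L (M / 4) * K ^ 2 * l ^ 2) := by
    rcases min_cases L ((M : ℝ) / 4) with ⟨h, -⟩ | ⟨h, -⟩
    · rw [h]
      refine centered_mgf_le_of_density (p := fun a => P.real {a})
        (q := fun y => ∏ j, bernWeight (marginal P j) (y j)) (fun a => measureReal_nonneg)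
        (sum_real_singleton P) (one_le_of_bahadurFactor_le P hα hL) hK
        (real_singleton_le_of_bounded P hα hL) (g := fun a => F (bits a)) (fun l hl => ?_) hl
      exact bernoulli_exp_mul_exp_neg_le (marginal P) (fun j => ⟨(hα j).1.le, (hα j).2.le⟩)
        hF.convex hF.nonneg hF.lip hl
    · rw [h]
      refine (mgf_le_hoeffding P hK.le hF l).trans (Real.exp_le_exp.2 ?_)
      have : (4 : ℝ) ≤ Real.exp 4 := by linarith [Real.add_one_le_exp (4 : ℝ)]
      have h2 : 0 ≤ K ^ 2 * (M / 4) * l ^ 2 := by positivity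
      nlinarith
  have h2 : ∑ a, P.real {a} * Real.exp (l * F (bits a)) =
      (∑ a, P.real {a} * Real.exp (l * (F (bits a) - ∑ b, P.real {b} * F (bits b)))) *
        Real.exp (l * ∑ b, P.real {b} * F (bits b)) := by
    rw [Finset.sum_mul]
    refine Finset.sum_congr rfl fun a _ => ?_
    rw [mul_assoc, ← Real.exp_add]
    congr 2; ring
  rw [h2]
  exact mul_le_mul_of_nonneg_right h1 (Real.exp_pos _).le

/-- Subgaussian bound for a convex Lipschitz function of a sum of independent observations. -/
lemma prodSum_exp_le_of_bounded (P : Measure (Outcome M)) [IsProbabilityMeasure P]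
    (hα : ∀ j, 0 < marginal P j ∧ marginal P j < 1) {L : ℝ}
    (hL : ∀ y, bahadurFactor (marginal P) (corrCoef P) y ≤ L) {K : ℝ} (hK : 0 < K)
    {l : ℝ} (hl : 0 ≤ l) (N : ℕ) {F : (Fin M → ℝ) → ℝ} (hF : ConvexLip K F) (v : Fin M → ℝ) :
    prodSum (fun _ : Fin N => fun a => P.real {a})
        (fun y => Real.exp (l * F (v + ∑ i, bits (y i)))) ≤
      Real.exp (N * (Real.exp 4 * min L (M / 4) * K ^ 2 * l ^ 2)) *
        Real.exp (l * prodSum (fun _ : Fin N => fun a => P.real {a})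
          (fun y => F (v + ∑ i, bits (y i)))) := by
  induction N generalizing F v with
  | zero => simp [prodSum_zero]
  | succ N ih =>
    set p : Outcome M → ℝ := fun a => P.real {a} with hp
    set C := Real.exp 4 * min L (M / 4) * K ^ 2 * l ^ 2 with hC
    -- The conditional mean given the first observation, as a function of that observation, to which
    -- the one-observation bound applies.
    have hG : ConvexLip K fun x => prodSum (fun _ : Fin N => p)
        fun y => F (x + ∑ i, bits (y i)) := by
      refine ConvexLip.prodSum (fun _ _ => measureReal_nonneg) (fun _ => sum_real_singleton P)
        fun y => ?_
      simpa only [add_comm] using hF.translate (∑ i, bits (y i))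
    rw [prodSum_succ, prodSum_succ]
    simp only [Fin.sum_univ_succ, Fin.cons_zero, Fin.cons_succ]
    have e : ∀ (a : Outcome M) (y : Fin N → Outcome M), v + (bits a + ∑ i, bits (y i)) =
        (v + bits a) + ∑ i, bits (y i) := fun a y => (add_assoc _ _ _).symm
    simp only [e]
    calc _ ≤ ∑ a, p a * (Real.exp (N * C) * Real.exp (l * prodSum (fun _ : Fin N => p)
            fun y => F (v + bits a + ∑ i, bits (y i)))) :=
          Finset.sum_le_sum fun a _ =>
            mul_le_mul_of_nonneg_left (ih hF (v + bits a)) measureReal_nonneg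
      _ = Real.exp (N * C) * ∑ a, p a * Real.exp (l * prodSum (fun _ : Fin N => p)
            fun y => F (v + bits a + ∑ i, bits (y i))) := by
          rw [Finset.mul_sum]
          exact Finset.sum_congr rfl fun a _ => by ring
      _ ≤ Real.exp (N * C) * (Real.exp C * Real.exp (l * ∑ a, p a * prodSum (fun _ : Fin N => p)
            fun y => F (v + bits a + ∑ i, bits (y i)))) :=
          mul_le_mul_of_nonneg_left (mgf_le_of_bounded P hα hL hK (hG.translate v) hl)
            (Real.exp_pos _).le
      _ = _ := by
          rw [← mul_assoc, ← Real.exp_add]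
          congr 2
          push_cast; ring

/-- Upper deviations of a convex Lipschitz function of a sum of independent observations. -/
lemma deviation_le_of_bounded (P : Measure (Outcome M)) [IsProbabilityMeasure P] (hM : 1 ≤ M)
    (hα : ∀ j, 0 < marginal P j ∧ marginal P j < 1) {L : ℝ}
    (hL : ∀ y, bahadurFactor (marginal P) (corrCoef P) y ≤ L) {N : ℕ} (hN : 1 ≤ N)
    {K : ℝ} (hK : 0 < K) {F : (Fin M → ℝ) → ℝ} (hF : ConvexLip K F) {t : ℝ} (ht : 0 ≤ t) :
    (Measure.pi fun _ : Fin N => P).real {y |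
        (∫ y, F (∑ i, bits (y i)) ∂(Measure.pi fun _ : Fin N => P)) + t ≤ F (∑ i, bits (y i))} ≤
      Real.exp (-(t ^ 2 / (4 * Real.exp 4 * min L (M / 4) * K ^ 2 * N))) := by
  set m := min L ((M : ℝ) / 4) with hm
  have hm0 : 0 < m := by
    have h1 := one_le_of_bahadurFactor_le P hα hL
    have h2 : (1 : ℝ) ≤ M := by exact_mod_cast hM
    exact lt_min (by linarith) (by linarith)
  have hN0 : (0 : ℝ) < N := by exact_mod_cast hN
  have he := Real.exp_pos 4
  set D := Real.exp 4 * m * K ^ 2 * N with hD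
  have hD0 : 0 < D := by positivity
  -- The minimizer of D l² - l t.
  set l := t / (2 * D) with hl
  have hl0 : 0 ≤ l := by positivity
  refine (measure_ge_le_exp_mul_mgf (t := l) _ hl0 .of_finite).trans ?_
  have h1 := prodSum_exp_le_of_bounded P hα hL hK hl0 N hF 0
  simp only [zero_add] at h1
  rw [mgf, integral_pi_eq_prodSum, integral_pi_eq_prodSum]
  refine (mul_le_mul_of_nonneg_left h1 (Real.exp_pos _).le).trans_eq ?_
  rw [← Real.exp_add, ← Real.exp_add]
  congr 1
  have h2 : (N : ℝ) * (Real.exp 4 * m * K ^ 2 * l ^ 2) - l * t = -(t ^ 2 / (4 * D)) := by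
    rw [show (N : ℝ) * (Real.exp 4 * m * K ^ 2 * l ^ 2) = D * l ^ 2 by rw [hD]; ring, hl]
    field_simp
    ring
  rw [show 4 * Real.exp 4 * m * K ^ 2 * N = 4 * D by rw [hD]; ring, ← h2]
  ring

/-! ### Norms and moments of the estimation error. -/

lemma vecNorm_two_eq (v : Fin M → ℝ) : vecNorm 2 v = √(∑ j, v j ^ 2) := by
  simp [vecNorm, EuclideanSpace.norm_eq]

lemma vecNorm_one_le (v : Fin M → ℝ) : vecNorm 1 v ≤ √M * vecNorm 2 v := by
  have h1 : vecNorm 1 v = ∑ j, |v j| := by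
    simp [vecNorm, PiLp.norm_eq_of_L1]
  rw [h1, vecNorm_two_eq, ← Real.sqrt_mul (Nat.cast_nonneg _)]
  refine Real.le_sqrt_of_sq_le ?_
  have := sq_sum_le_card_mul_sum_sq (s := Finset.univ) (f := fun j => |v j|)
  simpa using this

lemma vecNorm_top_le {v : Fin M → ℝ} {c : ℝ} (hc : 0 ≤ c) (h : ∀ j, |v j| ≤ c) :
    vecNorm ⊤ v ≤ c := by
  rw [vecNorm, PiLp.norm_toLp, pi_norm_le_iff_of_nonneg hc]
  simpa using h

lemma convexLip_vecNorm {N : ℕ} (α : Fin M → ℝ) :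
    ConvexLip (1 / (N : ℝ)) fun v => vecNorm 2 ((1 / (N : ℝ)) • v - α) where
  convex := by
    refine ⟨convex_univ, fun x _ z _ a b ha hb hab => ?_⟩
    have e : (1 / (N : ℝ)) • (a • x + b • z) - α =
        a • ((1 / (N : ℝ)) • x - α) + b • ((1 / (N : ℝ)) • z - α) := by
      nth_rewrite 1 [← one_smul ℝ α]
      rw [← hab]
      module
    simp only [e, vecNorm, WithLp.toLp_add, WithLp.toLp_smul]
    refine (norm_add_le _ _).trans_eq ?_
    rw [norm_smul, norm_smul, Real.norm_of_nonneg ha, Real.norm_of_nonneg hb, smul_eq_mul,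
      smul_eq_mul]
  nonneg z := norm_nonneg _
  lip x z := by
    have e : 1 / (N : ℝ) * √(∑ j, (x j - z j) ^ 2) =
        vecNorm 2 ((1 / (N : ℝ)) • x - α - ((1 / (N : ℝ)) • z - α)) := by
      rw [sub_sub_sub_cancel_right, ← smul_sub, vecNorm, WithLp.toLp_smul, norm_smul,
        ← vecNorm, vecNorm_two_eq, Real.norm_of_nonneg (by positivity)]
      rfl
    rw [e]
    exact norm_sub_norm_le _ _

lemma alphaHat_eq_smul {N : ℕ} (y : Fin N → Outcome M) :
    alphaHat y = (1 / (N : ℝ)) • ∑ i, bits (y i) := by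
  ext j
  simp [alphaHat, bits]

/-- A variable with values in [0, 1] has variance at most 1/4, and variances of independent terms
add. Serves both the components and their pairwise products. -/
lemma integral_sq_mean_sub_le {N : ℕ} (hN : 1 ≤ N) (P : Measure (Outcome M))
    [IsProbabilityMeasure P] {u : Outcome M → ℝ} (hu : ∀ y, u y ∈ Set.Icc (0 : ℝ) 1) :
    ∫ y, (1 / (N : ℝ) * ∑ i, u (y i) - ∫ a, u a ∂P) ^ 2 ∂(Measure.pi fun _ : Fin N => P) ≤
      1 / (4 * (N : ℝ)) := by
  have hN0 : (0 : ℝ) < N := by exact_mod_cast hN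
  set Q := Measure.pi fun _ : Fin N => P with hQ
  have hmean : ∀ i, ∫ y, u (y i) ∂Q = ∫ a, u a ∂P := fun i => by
      have := integral_map (μ := Q) (φ := fun y => y i) (f := u)
        (measurable_pi_apply i).aemeasurable (measurable_of_finite u).aestronglyMeasurable
      rw [← this, (measurePreserving_eval (fun _ : Fin N => P) i).map_eq]
  have hvar : Var[∑ i, fun y : Fin N → Outcome M => u (y i); Q] ≤ N * (1 / 4) := by
    rw [IndepFun.variance_sum]
    · refine (Finset.sum_le_card_nsmul _ _ (1 / 4) fun i _ => ?_).trans_eq (by simp)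
      refine (variance_le_sq_of_bounded (a := 0) (b := 1) (ae_of_all _ fun y => hu _)
        (measurable_of_finite _).aemeasurable).trans_eq (by norm_num)
    · exact fun i _ => .of_discrete
    · intro i _ j _ hij
      exact (iIndepFun_pi (μ := fun _ : Fin N => P) (X := fun _ => u)
        fun i => (measurable_of_finite u).aemeasurable).indepFun hij
  rw [variance_eq_integral (measurable_of_finite _).aemeasurable] at hvar
  have e : ∀ y : Fin N → Outcome M, (1 / (N : ℝ) * ∑ i, u (y i) - ∫ a, u a ∂P) ^ 2 =
      (1 / (N : ℝ)) ^ 2 * ((∑ i, fun y : Fin N → Outcome M => u (y i)) y -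
        ∫ y, (∑ i, fun y : Fin N → Outcome M => u (y i)) y ∂Q) ^ 2 := by
    intro y
    have : ∫ y, (∑ i, fun y : Fin N → Outcome M => u (y i)) y ∂Q = N * ∫ a, u a ∂P := by
      simp only [Finset.sum_apply]
      rw [integral_finsetSum _ fun _ _ => .of_finite]
      simp [hmean]
    rw [this, Finset.sum_apply]
    field_simp
  simp only [e]
  rw [integral_const_mul]
  refine (mul_le_mul_of_nonneg_left hvar (by positivity)).trans_eq ?_
  field_simp

lemma Setting.isProbabilityMeasure {Ω : Type*} [MeasurableSpace Ω] {μ : Measure Ω}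
    [IsProbabilityMeasure μ] {N : ℕ} (hN : 1 ≤ N) {Y : Fin N → Ω → Outcome M}
    {P : Measure (Outcome M)} {s : ℕ} {Lbar ε ξ η : ℝ} (h : Setting μ Y P s Lbar ε ξ η) :
    IsProbabilityMeasure P := by
  rw [← h.law ⟨0, hN⟩]
  exact Measure.isProbabilityMeasure_map (h.measurable _).aemeasurable

/-- Independence with common law `P` moves every event about the data to the product law on a finite
space, where measurability is automatic. -/
lemma Setting.measureReal_eq {Ω : Type*} [MeasurableSpace Ω] {μ : Measure Ω}
    [IsProbabilityMeasure μ] {N : ℕ} {Y : Fin N → Ω → Outcome M}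
    {P : Measure (Outcome M)} {s : ℕ} {Lbar ε ξ η : ℝ} (h : Setting μ Y P s Lbar ε ξ η)
    (A : Set (Fin N → Outcome M)) :
    μ.real {ω | (fun i => Y i ω) ∈ A} = (Measure.pi fun _ : Fin N => P).real A := by
  have e := (iIndepFun_iff_map_fun_eq_pi_map fun i => (h.measurable i).aemeasurable).1 h.indep
  simp only [h.law] at e
  rw [← e, map_measureReal_apply (measurable_pi_lambda _ h.measurable) (Set.toFinite A).measurableSet]
  rfl

lemma Setting.marginal_mem_Ioo {Ω : Type*} [MeasurableSpace Ω] {μ : Measure Ω}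
    {N : ℕ} {Y : Fin N → Ω → Outcome M}
    {P : Measure (Outcome M)} {s : ℕ} {Lbar ε ξ η : ℝ} (h : Setting μ Y P s Lbar ε ξ η)
    (j : Fin M) : 0 < marginal P j ∧ marginal P j < 1 :=
  ⟨h.eta_pos.trans (h.marginal_mem j).1, by linarith [(h.marginal_mem j).2, h.eta_pos]⟩

lemma integral_sq_vecNorm_le {N : ℕ} (hN : 1 ≤ N) (P : Measure (Outcome M))
    [IsProbabilityMeasure P] :
    ∫ y, vecNorm 2 (alphaHat y - marginal P) ^ 2 ∂(Measure.pi fun _ : Fin N => P) ≤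
      M / (4 * (N : ℝ)) := by
  have e : ∀ y : Fin N → Outcome M, vecNorm 2 (alphaHat y - marginal P) ^ 2 =
      ∑ j, (1 / (N : ℝ) * ∑ i, bit (y i j) - ∫ a, bit (a j) ∂P) ^ 2 := by
    intro y
    rw [vecNorm_two_eq, Real.sq_sqrt (Finset.sum_nonneg fun j _ => sq_nonneg _)]
    simp only [integral_bit]
    rfl
  simp only [e]
  rw [integral_finsetSum _ fun _ _ => .of_finite]
  refine (Finset.sum_le_card_nsmul _ _ (1 / (4 * (N : ℝ))) fun j _ =>
    integral_sq_mean_sub_le hN P fun y => bit_mem (y j)).trans_eq ?_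
  simp [div_eq_mul_inv]

lemma integral_vecNorm_le {N : ℕ} (hN : 1 ≤ N) (P : Measure (Outcome M))
    [IsProbabilityMeasure P] :
    ∫ y, vecNorm 2 (alphaHat y - marginal P) ∂(Measure.pi fun _ : Fin N => P) ≤
      √((M : ℝ) / N) := by
  have hN0 : (0 : ℝ) < N := by exact_mod_cast hN
  refine Real.le_sqrt_of_sq_le ?_
  have h1 := variance_nonneg (fun y : Fin N → Outcome M => vecNorm 2 (alphaHat y - marginal P))
    (Measure.pi fun _ : Fin N => P)
  rw [variance_eq_sub .of_discrete, sub_nonneg] at h1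
  refine h1.trans ((integral_sq_vecNorm_le hN P).trans ?_)
  rw [div_le_div_iff₀ (by positivity) hN0]
  have : (0 : ℝ) ≤ M := Nat.cast_nonneg _
  nlinarith

/-- Hoeffding's inequality for one component of the sample mean. -/
lemma component_deviation_le {N : ℕ} (hN : 1 ≤ N) (P : Measure (Outcome M))
    [IsProbabilityMeasure P] (j : Fin M) {t : ℝ} (ht : 0 ≤ t) :
    (Measure.pi fun _ : Fin N => P).real {y | t ≤ |alphaHat y j - marginal P j|} ≤
      2 * Real.exp (-(2 * N * t ^ 2)) := by
  have hN0 : (0 : ℝ) < N := by exact_mod_cast hN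
  set Q := Measure.pi fun _ : Fin N => P with hQ
  have hsub : HasSubgaussianMGF (fun a : Outcome M => bit (a j) - marginal P j)
      ((‖(1 : ℝ) - 0‖₊ / 2) ^ 2) P := by
    have := hasSubgaussianMGF_of_mem_Icc (μ := P) (X := fun a => bit (a j)) (a := 0) (b := 1)
      (measurable_of_finite _).aemeasurable (ae_of_all _ fun a => bit_mem (a j))
    rwa [integral_bit] at this
  have tail : ∀ u : Outcome M → ℝ, HasSubgaussianMGF u ((‖(1 : ℝ) - 0‖₊ / 2) ^ 2) P →
      Q.real {y | N * t ≤ ∑ i, u (y i)} ≤ Real.exp (-(2 * N * t ^ 2)) := by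
    intro u hu
    have h1 := HasSubgaussianMGF.measure_sum_ge_le_of_iIndepFun (μ := Q) (s := Finset.univ)
      (X := fun (i : Fin N) y => u (y i)) (c := fun _ => (‖(1 : ℝ) - 0‖₊ / 2) ^ 2)
      (iIndepFun_pi (μ := fun _ : Fin N => P) (X := fun _ => u)
        fun i => (measurable_of_finite u).aemeasurable)
      (fun i _ => HasSubgaussianMGF.of_map (measurable_pi_apply i).aemeasurable (X := u) (by
        rwa [(measurePreserving_eval (fun _ : Fin N => P) i).map_eq]))
      (ε := N * t) (by positivity)
    refine h1.trans_eq ?_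
    congr 1
    simp
    field_simp
  have hsubset : {y : Fin N → Outcome M | t ≤ |alphaHat y j - marginal P j|} ⊆
      {y | N * t ≤ ∑ i, (bit (y i j) - marginal P j)} ∪
        {y | N * t ≤ ∑ i, -(bit (y i j) - marginal P j)} := by
    intro y hy
    have e : ∑ i, (bit (y i j) - marginal P j) = N * (alphaHat y j - marginal P j) := by
      simp [alphaHat]
      field_simp
    simp only [Set.mem_union, Set.mem_ofPred_eq, Finset.sum_neg_distrib, e, ← mul_neg]
    rcases le_abs.1 (Set.mem_ofPred_eq ▸ hy) with h | h
    · exact Or.inl (mul_le_mul_of_nonneg_left h hN0.le)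
    · exact Or.inr (mul_le_mul_of_nonneg_left h hN0.le)
  refine (measureReal_mono hsubset).trans ((measureReal_union_le _ _).trans ?_)
  rw [two_mul]
  exact add_le_add (tail _ hsub) (tail (fun a => -(bit (a j) - marginal P j)) hsub.neg)

lemma exists_component_deviation_le {N : ℕ} (hN : 1 ≤ N) (P : Measure (Outcome M))
    [IsProbabilityMeasure P] {t : ℝ} (ht : 0 ≤ t) :
    (Measure.pi fun _ : Fin N => P).real {y | ∃ j, t ≤ |alphaHat y j - marginal P j|} ≤
      M * (2 * Real.exp (-(2 * N * t ^ 2))) := by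
  rw [Set.ofPred_exists]
  refine (measureReal_iUnion_fintype_le _).trans ?_
  refine (Finset.sum_le_card_nsmul _ _ _ fun j _ => component_deviation_le hN P j ht).trans_eq ?_
  simp

/-! ### Failure probabilities of the three norm bounds. -/

lemma exp_four_le : Real.exp 4 ≤ 81 := by
  have h := Real.exp_one_lt_d9
  have : Real.exp 4 = Real.exp 1 ^ 4 := by rw [← Real.exp_nat_mul]; norm_num
  rw [this, show (81 : ℝ) = 3 ^ 4 by norm_num]
  exact pow_le_pow_left₀ (Real.exp_pos _).le (by linarith) 4

lemma euclidean_failure_le_sq {N : ℕ} (hM : 1 ≤ M) (hN : 1 ≤ N) (P : Measure (Outcome M))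
    [IsProbabilityMeasure P] (hα : ∀ j, 0 < marginal P j ∧ marginal P j < 1) {L : ℝ}
    (hL : ∀ y, bahadurFactor (marginal P) (corrCoef P) y ≤ L) {δ : ℝ} (h0 : 0 < δ) (h1 : δ < 1) :
    (Measure.pi fun _ : Fin N => P).real {y | √((M : ℝ) / N) +
        30 * √(Real.log (1 / δ) * min L (M / 4) / N) < vecNorm 2 (alphaHat y - marginal P)} ≤
      δ ^ 2 := by
  have hN0 : (0 : ℝ) < N := by exact_mod_cast hN
  have hm0 : 0 < min L ((M : ℝ) / 4) := by
    have h1 := one_le_of_bahadurFactor_le P hα hL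
    have h2 : (1 : ℝ) ≤ M := by exact_mod_cast hM
    exact lt_min (by linarith) (by linarith)
  set m := min L ((M : ℝ) / 4)
  have hT : 0 < Real.log (1 / δ) := Real.log_pos (by rw [lt_div_iff₀ h0]; linarith)
  have hdev := deviation_le_of_bounded P hM hα hL hN (K := 1 / (N : ℝ)) (by positivity)
    (convexLip_vecNorm (N := N) (marginal P)) (t := 30 * √(Real.log (1 / δ) * m / N))
    (by positivity)
  simp only [← alphaHat_eq_smul] at hdev
  refine (measureReal_mono fun y hy => ?_).trans (hdev.trans ?_)
  · have := integral_vecNorm_le (M := M) hN P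
    simp only [Set.mem_ofPred_eq] at hy ⊢
    linarith
  · have h2 : δ ^ 2 = Real.exp (-(2 * Real.log (1 / δ))) := by
      rw [one_div, Real.log_inv, mul_neg, neg_neg, mul_comm, Real.exp_mul, Real.exp_log h0]
      norm_num
    rw [h2]
    refine Real.exp_le_exp.2 (neg_le_neg ?_)
    rw [mul_pow, Real.sq_sqrt (by positivity), le_div_iff₀ (by have := Real.exp_pos 4; positivity)]
    -- The constant 30 is chosen so that 30² = 900 exceeds 8 exp(4), itself at most 648.
    have e4 := exp_four_le
    have : 2 * Real.log (1 / δ) * (4 * Real.exp 4 * m * (1 / (N : ℝ)) ^ 2 * N) =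
        (8 * Real.exp 4) * (Real.log (1 / δ) * m / N) := by
      field_simp; ring
    rw [this]
    refine mul_le_mul_of_nonneg_right ?_ (by positivity)
    linarith

/-- Markov's inequality for the squared error. It takes over for `δ` near 1, where the logarithmic
term degenerates. -/
lemma euclidean_failure_le_quarter {N : ℕ} (hM : 1 ≤ M) (hN : 1 ≤ N) (P : Measure (Outcome M))
    [IsProbabilityMeasure P] :
    (Measure.pi fun _ : Fin N => P).real {y | √((M : ℝ) / N) <
      vecNorm 2 (alphaHat y - marginal P)} ≤ 1 / 4 := by
  have hN0 : (0 : ℝ) < N := by exact_mod_cast hN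
  have hM0 : (0 : ℝ) < M := by exact_mod_cast hM
  have h1 := mul_meas_ge_le_integral_of_nonneg (μ := Measure.pi fun _ : Fin N => P)
    (f := fun y => vecNorm 2 (alphaHat y - marginal P) ^ 2) (ae_of_all _ fun y => sq_nonneg _)
    .of_finite ((M : ℝ) / N)
  have h2 := h1.trans (integral_sq_vecNorm_le hN P)
  have h3 : (M : ℝ) / (4 * N) = M / N * (1 / 4) := by field_simp
  rw [h3] at h2
  refine (measureReal_mono fun y hy => ?_).trans (le_of_mul_le_mul_left h2 (by positivity))
  have hy' : √((M : ℝ) / N) < vecNorm 2 (alphaHat y - marginal P) := hy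
  exact (Real.sqrt_le_left (norm_nonneg _)).1 hy'.le

lemma sup_failure_le {N : ℕ} (hM : 2 ≤ M) (hN : 1 ≤ N) (P : Measure (Outcome M))
    [IsProbabilityMeasure P] {δ : ℝ} (h0 : 0 < δ) (h1 : δ < 1) :
    (Measure.pi fun _ : Fin N => P).real {y | 30 * √(Real.log (M / δ) / N) <
      vecNorm ⊤ (alphaHat y - marginal P)} ≤ δ ^ 3 / 2 := by
  have hN0 : (0 : ℝ) < N := by exact_mod_cast hN
  have hM0 : (2 : ℝ) ≤ M := by exact_mod_cast hM
  set t := 30 * √(Real.log (M / δ) / N) with ht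
  have ht0 : 0 ≤ t := by positivity
  have hlog : 0 ≤ Real.log (M / δ) := Real.log_nonneg (by rw [le_div_iff₀ h0]; linarith)
  refine (measureReal_mono (s₂ := {y | ∃ j, t ≤ |alphaHat y j - marginal P j|})
    fun y hy => ?_).trans ((exists_component_deviation_le hN P ht0).trans ?_)
  · by_contra hcon
    simp only [Set.mem_ofPred_eq, not_exists, not_le] at hcon hy
    exact absurd hy (not_lt.2 (vecNorm_top_le ht0 fun j => (hcon j).le))
  · have e1 : Real.exp (-(2 * N * t ^ 2)) ≤ (δ / M) ^ 3 := by
      have : (δ / M) ^ 3 = Real.exp (-(3 * Real.log (M / δ))) := by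
        rw [mul_comm, ← neg_mul, Real.exp_mul, Real.exp_neg, Real.exp_log (by positivity), inv_div]
        norm_num
      rw [this, ht, mul_pow, Real.sq_sqrt (by positivity)]
      refine Real.exp_le_exp.2 (neg_le_neg ?_)
      have : 2 * (N : ℝ) * (30 ^ 2 * (Real.log (M / δ) / N)) = 1800 * Real.log (M / δ) := by
        field_simp; ring
      rw [this]
      linarith
    have e2 : (M : ℝ) * (2 * (δ / M) ^ 3) = δ ^ 3 * (2 / M ^ 2) := by field_simp
    have e3 : (2 : ℝ) / M ^ 2 ≤ 1 / 2 := by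
      rw [div_le_div_iff₀ (by positivity) (by norm_num)]; nlinarith
    calc _ ≤ (M : ℝ) * (2 * (δ / M) ^ 3) := by gcongr
      _ = δ ^ 3 * (2 / M ^ 2) := e2
      _ ≤ δ ^ 3 * (1 / 2) := by gcongr
      _ = _ := by ring

/-- The three norm bounds under the product law. -/
theorem norm_bounds {N : ℕ} (hM : 2 ≤ M) (hN : 1 ≤ N) (P : Measure (Outcome M))
    [IsProbabilityMeasure P] (hα : ∀ j, 0 < marginal P j ∧ marginal P j < 1) {L : ℝ}
    (hL : ∀ y, bahadurFactor (marginal P) (corrCoef P) y ≤ L) {δ : ℝ} (h0 : 0 < δ) (h1 : δ < 1) :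
    1 - δ ≤ (Measure.pi fun _ : Fin N => P).real {y |
      vecNorm 1 (alphaHat y - marginal P) ≤
          M / √(N : ℝ) + 30 * √(M * Real.log (1 / δ) * min L (M / 4) / N) ∧
      vecNorm 2 (alphaHat y - marginal P) ≤
          √((M : ℝ) / N) + 30 * √(Real.log (1 / δ) * min L (M / 4) / N) ∧
      vecNorm ⊤ (alphaHat y - marginal P) ≤ 30 * √(Real.log (M / δ) / N)} := by
  set Q := Measure.pi fun _ : Fin N => P with hQ
  set B₂ : Set (Fin N → Outcome M) := {y | √((M : ℝ) / N) +
    30 * √(Real.log (1 / δ) * min L (M / 4) / N) < vecNorm 2 (alphaHat y - marginal P)} with hB₂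
  set B₃ : Set (Fin N → Outcome M) := {y | 30 * √(Real.log (M / δ) / N) <
      vecNorm ⊤ (alphaHat y - marginal P)} with hB₃
  have hB : Q.real (B₂ ∪ B₃) ≤ δ := by
    refine (measureReal_union_le _ _).trans ?_
    have h3 := sup_failure_le hM hN P h0 h1
    -- For small `δ` the failures add up to at most δ² + δ³/2; for large `δ` to at most 1/4 + δ³/2.
    -- Both are below `δ` on their range.
    rcases le_total δ (1 / 2) with h | h
    · have h2 := euclidean_failure_le_sq (by lia) hN P hα hL h0 h1
      have : δ ^ 3 ≤ δ ^ 2 := by nlinarith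
      nlinarith
    · have h2 : Q.real B₂ ≤ 1 / 4 := by
        refine (measureReal_mono fun y hy => ?_).trans
          (euclidean_failure_le_quarter (M := M) (by lia) hN P)
        simp only [hB₂, Set.mem_ofPred_eq] at hy ⊢
        exact lt_of_le_of_lt (le_add_of_nonneg_right (by positivity)) hy
      have : δ - δ ^ 3 / 2 - 1 / 4 ≥ 0 := by
        nlinarith [mul_nonneg (sub_nonneg.2 h) (sub_nonneg.2 h1.le), mul_nonneg h0.le
          (mul_nonneg (sub_nonneg.2 h) (sub_nonneg.2 h1.le))]
      linarith
  have hcompl : Q.real (B₂ ∪ B₃)ᶜ = 1 - Q.real (B₂ ∪ B₃) :=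
    probReal_compl_eq_one_sub (Set.toFinite _).measurableSet
  refine (by linarith : 1 - δ ≤ Q.real (B₂ ∪ B₃)ᶜ).trans (measureReal_mono fun y hy => ?_)
  simp only [Set.mem_compl_iff, Set.mem_union, not_or, hB₂, hB₃, Set.mem_ofPred_eq, not_lt] at hy
  refine ⟨?_, hy.1, hy.2⟩
  refine (vecNorm_one_le _).trans ((mul_le_mul_of_nonneg_left hy.1 (Real.sqrt_nonneg _)).trans_eq ?_)
  rw [mul_add, Real.sqrt_div (Nat.cast_nonneg _), ← mul_div_assoc,
    Real.mul_self_sqrt (Nat.cast_nonneg _), mul_left_comm, ← Real.sqrt_mul (Nat.cast_nonneg _)]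
  congr 3
  ring

/-! ### Covariance matrices and Gaussian limits. -/

/-- Weighted second moments of a finite family of outcomes. -/
def pairMoment {β : Type*} [Fintype β] (w : β → ℝ) (X : β → Outcome M) (j k : Fin M) : ℝ :=
  ∑ b, w b * (bit (X b j) * bit (X b k))

/-- The covariance matrix with given second moments of a binary vector. -/
def covMat (m : Fin M → Fin M → ℝ) : Matrix (Fin M) (Fin M) ℝ :=
  Matrix.of fun j k => m j k - m j j * m k k

lemma bit_mul_self (b : Bool) : bit b * bit b = bit b := by cases b <;> simp [bit]

/-- Bits are idempotent, so the diagonal second moments are the means and the second moments alone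
determine the covariance. One identity covers both the law and the sample. -/
lemma quadForm_covMat {β : Type*} [Fintype β] {w : β → ℝ} (hw : ∑ b, w b = 1)
    (X : β → Outcome M) (t : Fin M → ℝ) :
    t ⬝ᵥ (covMat (pairMoment w X)).mulVec t =
      ∑ b, w b * (∑ j, t j * (bit (X b j) - pairMoment w X j j)) ^ 2 := by
  have e : ∀ j k, covMat (pairMoment w X) j k = ∑ b, w b *
      ((bit (X b j) - pairMoment w X j j) * (bit (X b k) - pairMoment w X k k)) := by
    intro j k
    have e1 : ∀ j, ∑ b, w b * bit (X b j) = pairMoment w X j j := fun j => by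
      simp [pairMoment, bit_mul_self]
    have e2 : ∀ b, w b *
        ((bit (X b j) - pairMoment w X j j) * (bit (X b k) - pairMoment w X k k)) =
        w b * (bit (X b j) * bit (X b k)) - w b * bit (X b j) * pairMoment w X k k -
          w b * bit (X b k) * pairMoment w X j j + w b * (pairMoment w X j j * pairMoment w X k k) :=
      fun b => by ring
    simp only [e2]
    rw [Finset.sum_add_distrib, Finset.sum_sub_distrib, Finset.sum_sub_distrib, ← Finset.sum_mul,
      ← Finset.sum_mul, ← Finset.sum_mul, e1, e1, hw]
    simp only [covMat, Matrix.of_apply]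
    rw [show ∑ b, w b * (bit (X b j) * bit (X b k)) = pairMoment w X j k from rfl]
    ring
  simp only [dotProduct, Matrix.mulVec, e, pow_two, Finset.sum_mul_sum]
  simp only [Finset.mul_sum, Finset.sum_mul]
  rw [Finset.sum_comm' (t' := Finset.univ) (s' := fun _ => Finset.univ) (by simp)]
  rw [Finset.sum_comm]
  simp only [Finset.sum_comm (s := (Finset.univ : Finset (Fin M))) (t := (Finset.univ : Finset β))]
  refine Finset.sum_congr rfl fun b _ => ?_
  refine Finset.sum_congr rfl fun j _ => Finset.sum_congr rfl fun k _ => ?_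
  ring

lemma covMat_isHermitian {m : Fin M → Fin M → ℝ} (hm : ∀ j k, m j k = m k j) :
    (covMat m).IsHermitian := by
  ext j k
  simp [covMat, hm j k, mul_comm]

lemma pairMoment_comm {β : Type*} [Fintype β] (w : β → ℝ) (X : β → Outcome M) (j k : Fin M) :
    pairMoment w X j k = pairMoment w X k j := by
  simp [pairMoment, mul_comm]

lemma posSemidef_covMat_pairMoment {β : Type*} [Fintype β] {w : β → ℝ} (hw0 : ∀ b, 0 ≤ w b)
    (hw : ∑ b, w b = 1) (X : β → Outcome M) : (covMat (pairMoment w X)).PosSemidef := by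
  refine .of_dotProduct_mulVec_nonneg (covMat_isHermitian (pairMoment_comm w X)) fun t => ?_
  rw [star_trivial, quadForm_covMat hw]
  exact Finset.sum_nonneg fun b _ => mul_nonneg (hw0 b) (sq_nonneg _)

lemma continuous_quadForm_covMat (t : Fin M → ℝ) :
    Continuous fun m : Fin M → Fin M → ℝ => t ⬝ᵥ (covMat m).mulVec t := by
  simp only [dotProduct, Matrix.mulVec, covMat, Matrix.of_apply]
  fun_prop

/-- The limit of second moments is only known as a limit, yet the characteristic function of
`multivariateGaussian` requires a positive semidefinite matrix. -/
lemma posSemidef_covMat_of_tendsto {m : Fin M → Fin M → ℝ} {u : ℕ → Fin M → Fin M → ℝ}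
    (hsymm : ∀ n j k, u n j k = u n k j) (hu : Tendsto u atTop (𝓝 m))
    (h : ∀ n, (covMat (u n)).PosSemidef) : (covMat m).PosSemidef := by
  have hjk : ∀ j k, Tendsto (fun n => u n j k) atTop (𝓝 (m j k)) := fun j k =>
    tendsto_pi_nhds.1 (tendsto_pi_nhds.1 hu j) k
  refine .of_dotProduct_mulVec_nonneg (covMat_isHermitian fun j k => ?_) fun t => ?_
  · refine tendsto_nhds_unique (hjk j k) ?_
    simpa only [hsymm] using hjk k j
  · rw [star_trivial]
    refine ge_of_tendsto ((continuous_quadForm_covMat t).continuousAt.tendsto.comp hu)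
      (Eventually.of_forall fun n => ?_)
    simpa using (h n).dotProduct_mulVec_nonneg t

/-- Second moments of a law on outcomes. -/
def lawMoment (P : Measure (Outcome M)) : Fin M → Fin M → ℝ := pairMoment (fun a => P.real {a}) id

/-- Second moments of a sample. -/
def sampleMoment {N : ℕ} (y : Fin N → Outcome M) : Fin M → Fin M → ℝ :=
  pairMoment (fun _ : Fin N => 1 / (N : ℝ)) y

lemma lawMoment_eq_integral (P : Measure (Outcome M)) [IsProbabilityMeasure P] (j k : Fin M) :
    lawMoment P j k = ∫ a, bit (a j) * bit (a k) ∂P := by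
  rw [integral_fintype .of_finite]; rfl

lemma lawMoment_self (P : Measure (Outcome M)) [IsProbabilityMeasure P] (j : Fin M) :
    lawMoment P j j = marginal P j := by
  rw [lawMoment_eq_integral]
  simp only [bit_mul_self, integral_bit]

lemma sampleMoment_eq {N : ℕ} (y : Fin N → Outcome M) (j k : Fin M) :
    sampleMoment y j k = 1 / (N : ℝ) * ∑ i, bit (y i j) * bit (y i k) := by
  rw [Finset.mul_sum]; rfl

lemma sampleMoment_self {N : ℕ} (y : Fin N → Outcome M) (j : Fin M) :
    sampleMoment y j j = alphaHat y j := by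
  simp [sampleMoment_eq, bit_mul_self, alphaHat]

lemma sum_one_div {N : ℕ} (hN : 1 ≤ N) : ∑ _i : Fin N, 1 / (N : ℝ) = 1 := by
  have : (N : ℝ) ≠ 0 := by positivity
  simp [this]

/-- The scaled sum of the deviations of the observations from `α`, with multipliers. -/
def scaledSum {N : ℕ} (y : Fin N → Outcome M) (α : Fin M → ℝ) (ξ : Fin N → ℝ) :
    EuclideanSpace ℝ (Fin M) :=
  WithLp.toLp 2 fun j => (√(N : ℝ))⁻¹ * ∑ i, ξ i * (bit (y i j) - α j)

lemma inner_scaledSum {N : ℕ} (y : Fin N → Outcome M) (α : Fin M → ℝ) (ξ : Fin N → ℝ)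
    (t : EuclideanSpace ℝ (Fin M)) :
    inner ℝ (scaledSum y α ξ) t =
      ∑ i, ξ i * ((√(N : ℝ))⁻¹ * ∑ j, t j * (bit (y i j) - α j)) := by
  simp only [scaledSum, PiLp.inner_apply, RCLike.inner_apply, conj_trivial, Finset.mul_sum]
  rw [Finset.sum_comm]
  exact Finset.sum_congr rfl fun i _ => Finset.sum_congr rfl fun j _ => by ring

/-- The law of the Gaussian multiplier sum. -/
def bootLaw {N : ℕ} (y : Fin N → Outcome M) : Measure (EuclideanSpace ℝ (Fin M)) :=
  (Measure.pi fun _ : Fin N => gaussianReal 0 1).map (scaledSum y (alphaHat y))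

lemma measurable_scaledSum {N : ℕ} (y : Fin N → Outcome M) (α : Fin M → ℝ) :
    Measurable (scaledSum y α) := by
  unfold scaledSum
  refine (WithLp.measurable_toLp 2 _).comp (measurable_pi_lambda _ fun j => ?_)
  fun_prop

instance {N : ℕ} (y : Fin N → Outcome M) : IsProbabilityMeasure (bootLaw y) :=
  Measure.isProbabilityMeasure_map (measurable_scaledSum y _).aemeasurable

/-- Given the data, the multiplier sum is linear in independent Gaussians, so this is an exact
identity for each `N`, not a limit. -/
lemma charFun_bootLaw {N : ℕ} (hN : 1 ≤ N) (y : Fin N → Outcome M)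
    (t : EuclideanSpace ℝ (Fin M)) :
    charFun (bootLaw y) t =
      Complex.exp (-((t : Fin M → ℝ) ⬝ᵥ (covMat (sampleMoment y)).mulVec t : ℝ) / 2) := by
  rw [bootLaw, charFun_apply, integral_map (measurable_scaledSum y _).aemeasurable
    (by fun_prop)]
  simp only [inner_scaledSum]
  push_cast
  simp only [Finset.sum_mul, Complex.exp_sum]
  rw [integral_fintype_prod_eq_prod (𝕜 := ℂ) (fun (i : Fin N) (x : ℝ) => Complex.exp ((x : ℂ) *
    (((√(N : ℝ)) : ℂ)⁻¹ * ∑ j, (t j : ℂ) * ((bit (y i j) : ℂ) - (alphaHat y j : ℂ))) * Complex.I))]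
  have e : ∀ i, ∫ x : ℝ, Complex.exp ((x : ℂ) *
      (((√(N : ℝ)) : ℂ)⁻¹ * ∑ j, (t j : ℂ) * ((bit (y i j) : ℂ) - (alphaHat y j : ℂ))) *
        Complex.I) ∂(gaussianReal 0 1) =
      Complex.exp (-((1 / (N : ℝ) * (∑ j, t j * (bit (y i j) - alphaHat y j)) ^ 2 : ℝ) : ℂ) / 2) := by
    intro i
    have := charFun_gaussianReal (μ := 0) (v := 1)
      ((√(N : ℝ))⁻¹ * ∑ j, t j * (bit (y i j) - alphaHat y j))
    rw [charFun_apply_real] at this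
    push_cast at this ⊢
    refine Eq.trans ?_ (this.trans ?_)
    · congr 1
      ext x
      congr 1; ring
    · congr 1
      have hs : ((√(N : ℝ) : ℝ) : ℂ) ^ 2 = N := by
        rw [← Complex.ofReal_pow, Real.sq_sqrt (Nat.cast_nonneg _)]; simp
      rw [mul_pow, inv_pow, hs]
      ring
  rw [Finset.prod_congr rfl fun i _ => e i, ← Complex.exp_sum]
  congr 1
  rw [← Finset.sum_div, Finset.sum_neg_distrib, ← Complex.ofReal_sum]
  congr 3
  rw [sampleMoment, quadForm_covMat (sum_one_div hN)]
  have hself := sampleMoment_self y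
  simp only [sampleMoment] at hself
  simp only [hself]

/-- The law of the scaled sum of the centered observations. -/
def sampleLaw (N : ℕ) (P : Measure (Outcome M)) : Measure (EuclideanSpace ℝ (Fin M)) :=
  (Measure.pi fun _ : Fin N => P).map fun y => scaledSum y (marginal P) 1

instance (N : ℕ) (P : Measure (Outcome M)) [IsProbabilityMeasure P] :
    IsProbabilityMeasure (sampleLaw N P) :=
  Measure.isProbabilityMeasure_map (measurable_of_finite _).aemeasurable

lemma charFun_sampleLaw (N : ℕ) (P : Measure (Outcome M)) [IsProbabilityMeasure P]
    (t : EuclideanSpace ℝ (Fin M)) :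
    charFun (sampleLaw N P) t =
      (∫ a, Complex.exp (((√(N : ℝ))⁻¹ * ∑ j, t j * (bit (a j) - marginal P j) : ℝ) *
        Complex.I) ∂P) ^ N := by
  rw [sampleLaw, charFun_apply, integral_map (measurable_of_finite _).aemeasurable (by fun_prop)]
  simp only [inner_scaledSum, Pi.one_apply, one_mul]
  have := integral_fintype_prod_eq_pow (ι := Fin N) (𝕜 := ℂ) (μ := P) (fun a : Outcome M =>
    Complex.exp (((√(N : ℝ))⁻¹ * ∑ j, t j * (bit (a j) - marginal P j) : ℝ) * Complex.I))
  rw [Fintype.card_fin] at this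
  rw [← this]
  congr 1
  ext y
  rw [← Complex.exp_sum, Complex.ofReal_sum, Finset.sum_mul]

/-- Lindeberg's telescoping: an error per observation of order N^(-3/2) remains negligible after `N`
factors. -/
lemma norm_pow_sub_pow_le {z w : ℂ} (hz : ‖z‖ ≤ 1) (hw : ‖w‖ ≤ 1) (n : ℕ) :
    ‖z ^ n - w ^ n‖ ≤ n * ‖z - w‖ := by
  induction n with
  | zero => simp
  | succ n ih =>
    have e : z ^ (n + 1) - w ^ (n + 1) = z ^ n * (z - w) + (z ^ n - w ^ n) * w := by ring
    rw [e]
    refine (norm_add_le _ _).trans ?_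
    rw [norm_mul, norm_mul, norm_pow]
    have h1 : ‖z‖ ^ n * ‖z - w‖ ≤ 1 * ‖z - w‖ :=
      mul_le_mul_of_nonneg_right (pow_le_one₀ (norm_nonneg _) hz) (norm_nonneg _)
    have h2 : ‖z ^ n - w ^ n‖ * ‖w‖ ≤ ‖z ^ n - w ^ n‖ * 1 :=
      mul_le_mul_of_nonneg_left hw (norm_nonneg _)
    push_cast
    linarith

/-- Second-order expansion of the characteristic function of a bounded centered variable. -/
lemma norm_integral_exp_sub_exp_le {α : Type*} [MeasurableSpace α] [Finite α]
    [MeasurableSingletonClass α] (P : Measure α) [IsProbabilityMeasure P] {X : α → ℝ} {c : ℝ}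
    (hc : ∀ a, |X a| ≤ c) (hc1 : c ≤ 1) (hmean : ∫ a, X a ∂P = 0) :
    ‖∫ a, Complex.exp (X a * Complex.I) ∂P - Complex.exp (-(∫ a, X a ^ 2 ∂P : ℝ) / 2)‖ ≤
      Real.exp 1 * (c ^ 3 + c ^ 4) := by
  obtain ⟨a₀⟩ := P.nonempty_of_neZero
  have hc0 : 0 ≤ c := (abs_nonneg _).trans (hc a₀)
  set v := ∫ a, X a ^ 2 ∂P with hv
  have hv0 : 0 ≤ v := integral_nonneg fun a => sq_nonneg _
  have hvc : v ≤ c ^ 2 := by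
    have := integral_mono (μ := P) (f := fun a => X a ^ 2) (g := fun _ => c ^ 2) .of_finite
      .of_finite fun a => sq_le_sq' (neg_le_of_abs_le (hc a)) (le_of_abs_le (hc a))
    simpa using this
  -- Both exponentials are compared with 1 - v/2; centering removes the linear term here.
  have h1 : ‖∫ a, Complex.exp (X a * Complex.I) ∂P - (1 - v / 2)‖ ≤ Real.exp 1 * c ^ 3 := by
    have e : (1 - (v : ℂ) / 2) = ∫ a, (1 + X a * Complex.I - (X a ^ 2 : ℝ) / 2 : ℂ) ∂P := by
      rw [integral_sub .of_finite .of_finite, integral_add .of_finite .of_finite,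
        integral_mul_const, integral_div, integral_complex_ofReal, integral_complex_ofReal, hmean]
      simp [hv]
    rw [e, ← integral_sub .of_finite .of_finite]
    refine (norm_integral_le_of_norm_le_const (C := Real.exp 1 * c ^ 3)
      (ae_of_all _ fun a => ?_)).trans_eq (by simp)
    have h := Complex.norm_exp_sub_sum_le_norm_mul_exp (X a * Complex.I) 3
    have e2 : Complex.exp (X a * Complex.I) - (1 + X a * Complex.I - (X a ^ 2 : ℝ) / 2 : ℂ) =
        Complex.exp (X a * Complex.I) -
          ∑ m ∈ Finset.range 3, (X a * Complex.I) ^ m / (m.factorial : ℂ) := by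
      simp [Finset.sum_range_succ, mul_pow]
      ring
    rw [e2]
    refine h.trans ?_
    rw [norm_mul, Complex.norm_I, mul_one, Complex.norm_real, Real.norm_eq_abs, mul_comm]
    exact mul_le_mul (Real.exp_le_exp.2 ((hc a).trans hc1))
      (pow_le_pow_left₀ (abs_nonneg _) (hc a) 3) (by positivity) (Real.exp_pos _).le
  have h2 : ‖Complex.exp (-(v : ℂ) / 2) - (1 - v / 2)‖ ≤ Real.exp 1 * c ^ 4 := by
    have h := Complex.norm_exp_sub_sum_le_norm_mul_exp (-(v : ℂ) / 2) 2
    have e2 : ∑ m ∈ Finset.range 2, (-(v : ℂ) / 2) ^ m / (m.factorial : ℂ) = 1 - v / 2 := by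
      simp [Finset.sum_range_succ]; ring
    rw [e2] at h
    have e3 : ‖-(v : ℂ) / 2‖ = v / 2 := by
      rw [norm_div, norm_neg, Complex.norm_real, Real.norm_of_nonneg hv0]; simp
    rw [e3] at h
    refine h.trans ?_
    rw [mul_comm]
    have h4 : c ^ 2 ≤ 1 := pow_le_one₀ hc0 hc1
    refine mul_le_mul (Real.exp_le_exp.2 (by linarith)) ?_ (by positivity) (Real.exp_pos _).le
    rw [show c ^ 4 = (c ^ 2) ^ 2 by ring]
    exact pow_le_pow_left₀ (by linarith) (by linarith) 2
  rw [mul_add, ← sub_sub_sub_cancel_right _ _ (1 - (v : ℂ) / 2)]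
  exact (norm_sub_le _ _).trans (add_le_add h1 h2)

/-- The centered Gaussian law with the covariance matrix given by second moments. -/
def gaussianLaw (m : Fin M → Fin M → ℝ) : ProbabilityMeasure (EuclideanSpace ℝ (Fin M)) :=
  ⟨multivariateGaussian 0 (covMat m), inferInstance⟩

/-- `bootLaw` as a probability measure. -/
def bootProb {N : ℕ} (y : Fin N → Outcome M) : ProbabilityMeasure (EuclideanSpace ℝ (Fin M)) :=
  ⟨bootLaw y, inferInstance⟩

/-- `sampleLaw` as a probability measure. -/
def sampleProb (N : ℕ) (P : Measure (Outcome M)) [IsProbabilityMeasure P] :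
    ProbabilityMeasure (EuclideanSpace ℝ (Fin M)) :=
  ⟨sampleLaw N P, inferInstance⟩

lemma coe_gaussianLaw (m : Fin M → Fin M → ℝ) :
    (gaussianLaw m : Measure (EuclideanSpace ℝ (Fin M))) = multivariateGaussian 0 (covMat m) := rfl

lemma coe_bootProb {N : ℕ} (y : Fin N → Outcome M) :
    (bootProb y : Measure (EuclideanSpace ℝ (Fin M))) = bootLaw y := rfl

lemma coe_sampleProb (N : ℕ) (P : Measure (Outcome M)) [IsProbabilityMeasure P] :
    (sampleProb N P : Measure (EuclideanSpace ℝ (Fin M))) = sampleLaw N P := rfl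

lemma charFun_gaussian_covMat {m : Fin M → Fin M → ℝ} (hm : (covMat m).PosSemidef)
    (t : EuclideanSpace ℝ (Fin M)) :
    charFun (multivariateGaussian 0 (covMat m)) t =
      Complex.exp (-((t : Fin M → ℝ) ⬝ᵥ (covMat m).mulVec t : ℝ) / 2) := by
  rw [charFun_multivariateGaussian hm, inner_zero_right]
  congr 1
  push_cast
  ring

lemma tendsto_exp_quadForm {m : Fin M → Fin M → ℝ} {u : ℕ → Fin M → Fin M → ℝ}
    (hu : Tendsto u atTop (𝓝 m)) (t : Fin M → ℝ) :
    Tendsto (fun k => Complex.exp (-(t ⬝ᵥ (covMat (u k)).mulVec t : ℝ) / 2)) atTop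
      (𝓝 (Complex.exp (-(t ⬝ᵥ (covMat m).mulVec t : ℝ) / 2))) := by
  have h : Continuous fun m : Fin M → Fin M → ℝ =>
      Complex.exp (-((t ⬝ᵥ (covMat m).mulVec t : ℝ) : ℂ) / 2) := by
    have := continuous_quadForm_covMat t
    fun_prop
  exact h.continuousAt.tendsto.comp hu

lemma tendsto_bootLaw {m : Fin M → Fin M → ℝ} (hm : (covMat m).PosSemidef) {N : ℕ → ℕ}
    (hN : ∀ k, 1 ≤ N k) {y : ∀ k, Fin (N k) → Outcome M}
    (hy : Tendsto (fun k => sampleMoment (y k)) atTop (𝓝 m)) :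
    Tendsto (fun k => bootProb (y k)) atTop
      (𝓝 (gaussianLaw m)) := by
  refine ProbabilityMeasure.tendsto_of_tendsto_charFun fun t => ?_
  simp only [coe_gaussianLaw, coe_bootProb, charFun_gaussian_covMat hm, charFun_bootLaw (hN _)]
  exact tendsto_exp_quadForm hy t

lemma abs_bit_sub_marginal_le (P : Measure (Outcome M)) [IsProbabilityMeasure P] (b : Bool)
    (j : Fin M) : |bit b - marginal P j| ≤ 1 := by
  have h1 : 0 ≤ marginal P j := measureReal_nonneg
  have h2 : marginal P j ≤ 1 := measureReal_le_one
  have h3 := bit_mem b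
  rw [abs_le]
  constructor <;> linarith [h3.1, h3.2]

/-- A quantitative central limit theorem for the characteristic function. -/
lemma norm_charFun_sampleLaw_sub_le {N : ℕ} (hN : 1 ≤ N) (P : Measure (Outcome M))
    [IsProbabilityMeasure P] (t : EuclideanSpace ℝ (Fin M))
    (hC : (∑ j, |t j|) / √(N : ℝ) ≤ 1) :
    ‖charFun (sampleLaw N P) t -
      Complex.exp (-((t : Fin M → ℝ) ⬝ᵥ (covMat (lawMoment P)).mulVec t : ℝ) / 2)‖ ≤
      Real.exp 1 * ((∑ j, |t j|) ^ 3 * (√(N : ℝ))⁻¹ + (∑ j, |t j|) ^ 4 * (√(N : ℝ))⁻¹ ^ 2) := by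
  have hN0 : (0 : ℝ) < N := by exact_mod_cast hN
  have hs0 : 0 < √(N : ℝ) := Real.sqrt_pos.2 hN0
  have hs2 : √(N : ℝ) ^ 2 = N := Real.sq_sqrt hN0.le
  set C := ∑ j, |t j| with hCdef
  set X : Outcome M → ℝ := fun a => (√(N : ℝ))⁻¹ * ∑ j, t j * (bit (a j) - marginal P j) with hX
  have hXc : ∀ a, |X a| ≤ C / √(N : ℝ) := by
    intro a
    rw [hX, abs_mul, abs_of_pos (inv_pos.2 hs0), mul_comm, div_eq_mul_inv]
    refine mul_le_mul_of_nonneg_right ?_ (inv_pos.2 hs0).le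
    refine (Finset.abs_sum_le_sum_abs _ _).trans (Finset.sum_le_sum fun j _ => ?_)
    rw [abs_mul]
    exact mul_le_of_le_one_right (abs_nonneg _) (abs_bit_sub_marginal_le P (a j) j)
  have hmean : ∫ a, X a ∂P = 0 := by
    rw [hX, integral_const_mul, integral_finsetSum _ fun _ _ => .of_finite]
    simp only [integral_const_mul]
    simp only [integral_sub Integrable.of_finite Integrable.of_finite, integral_bit]
    simp
  have hvar : ∫ a, X a ^ 2 ∂P =
      (1 / (N : ℝ)) * ((t : Fin M → ℝ) ⬝ᵥ (covMat (lawMoment P)).mulVec t) := by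
    rw [lawMoment, quadForm_covMat (sum_real_singleton P), integral_fintype .of_finite,
      Finset.mul_sum]
    refine Finset.sum_congr rfl fun a _ => ?_
    have hself := lawMoment_self P
    simp only [lawMoment] at hself
    simp only [hself, id, hX, smul_eq_mul, mul_pow, inv_pow, hs2]
    ring
  have hexp : Complex.exp (-((t : Fin M → ℝ) ⬝ᵥ (covMat (lawMoment P)).mulVec t : ℝ) / 2) =
      Complex.exp (-(∫ a, X a ^ 2 ∂P : ℝ) / 2) ^ N := by
    rw [← Complex.exp_nat_mul, hvar]
    congr 1
    push_cast
    have : (N : ℂ) ≠ 0 := by exact_mod_cast hN0.ne'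
    field_simp
  have hbd := norm_integral_exp_sub_exp_le P hXc hC hmean
  rw [charFun_sampleLaw, hexp]
  refine (norm_pow_sub_pow_le ?_ ?_ N).trans ((mul_le_mul_of_nonneg_left hbd hN0.le).trans_eq ?_)
  · refine (norm_integral_le_of_norm_le_const (C := 1) (ae_of_all _ fun a => ?_)).trans_eq (by simp)
    rw [Complex.norm_exp_ofReal_mul_I]
  · rw [Complex.norm_exp]
    refine Real.exp_le_one_iff.2 ?_
    have h0 : 0 ≤ ∫ a, X a ^ 2 ∂P := integral_nonneg fun a => sq_nonneg _
    rw [← Complex.ofReal_neg, ← Complex.ofReal_ofNat, ← Complex.ofReal_div, Complex.ofReal_re]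
    linarith
  · rw [div_eq_mul_inv]
    have hi : (√(N : ℝ))⁻¹ ^ 2 * N = 1 := by rw [inv_pow, hs2, inv_mul_cancel₀ hN0.ne']
    linear_combination (Real.exp 1 * (C ^ 3 * (√(N : ℝ))⁻¹ + C ^ 4 * (√(N : ℝ))⁻¹ ^ 2)) * hi

/-- The central limit theorem for triangular arrays of binary vectors. -/
lemma tendsto_sampleLaw {m : Fin M → Fin M → ℝ} (hm : (covMat m).PosSemidef) {N : ℕ → ℕ}
    (hN : Tendsto N atTop atTop) (P : ℕ → Measure (Outcome M)) [∀ k, IsProbabilityMeasure (P k)]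
    (hP : Tendsto (fun k => lawMoment (P k)) atTop (𝓝 m)) :
    Tendsto (fun k => sampleProb (N k) (P k)) atTop
      (𝓝 (gaussianLaw m)) := by
  refine ProbabilityMeasure.tendsto_of_tendsto_charFun fun t => ?_
  simp only [coe_gaussianLaw, coe_sampleProb, charFun_gaussian_covMat hm]
  have hs : Tendsto (fun k => (√(N k : ℝ))⁻¹) atTop (𝓝 0) :=
    tendsto_inv_atTop_zero.comp (Real.tendsto_sqrt_atTop.comp
      (tendsto_natCast_atTop_atTop.comp hN))
  set C := ∑ j, |t j| with hC
  have hdiff : Tendsto (fun k => charFun (sampleLaw (N k) (P k)) t -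
      Complex.exp (-((t : Fin M → ℝ) ⬝ᵥ (covMat (lawMoment (P k))).mulVec t : ℝ) / 2))
      atTop (𝓝 0) := by
    refine squeeze_zero_norm' (a := fun k => Real.exp 1 * (C ^ 3 * (√(N k : ℝ))⁻¹ +
      C ^ 4 * (√(N k : ℝ))⁻¹ ^ 2)) ?_ ?_
    · have h1 : ∀ᶠ k in atTop, C * (√(N k : ℝ))⁻¹ ≤ 1 := by
        have := hs.const_mul C
        rw [mul_zero] at this
        exact this.eventually_le_const one_pos
      filter_upwards [h1, hN.eventually_ge_atTop 1] with k hk1 hk2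
      exact norm_charFun_sampleLaw_sub_le hk2 (P k) t (by rwa [div_eq_mul_inv])
    · have := ((hs.const_mul (C ^ 3)).add ((hs.pow 2).const_mul (C ^ 4))).const_mul (Real.exp 1)
      simpa using this
  have := hdiff.add (tendsto_exp_quadForm hP t)
  simpa using this

/-! ### Gaussian boxes and the critical value. -/

/-- The standard deviations of a binary vector with given second moments. -/
def sdev (m : Fin M → Fin M → ℝ) (j : Fin M) : ℝ := √(m j j * (1 - m j j))

lemma sdev_sampleMoment {N : ℕ} (y : Fin N → Outcome M) : sdev (sampleMoment y) = sHat y := by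
  ext j
  rw [sdev, sHat, sampleMoment_self]

lemma continuous_sdev (j : Fin M) : Continuous fun m : Fin M → Fin M → ℝ => sdev m j := by
  unfold sdev
  fun_prop

/-- The distribution function of the largest standardized component of a Gaussian vector is
continuous, so it takes all values in `(0, 1)`. -/
lemma exists_box_measure_eq [NeZero M] {m : Fin M → Fin M → ℝ} (hm : (covMat m).PosSemidef)
    (hpos : ∀ j, 0 < sdev m j) {a : ℝ} (ha : 0 < a) (ha1 : a < 1) :
    ∃ t, (multivariateGaussian 0 (covMat m)).real {x | ∀ j, |x j| ≤ t * sdev m j} = a := by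
  set G := multivariateGaussian 0 (covMat m) with hG
  set h : EuclideanSpace ℝ (Fin M) → ℝ := fun x => ‖fun j => x j / sdev m j‖ with hh
  have hmeas : Measurable h := by
    refine Continuous.measurable (continuous_norm.comp (continuous_pi fun j => ?_))
    fun_prop
  have : IsProbabilityMeasure (G.map h) := Measure.isProbabilityMeasure_map hmeas.aemeasurable
  have hle : ∀ t x, h x ≤ t ↔ ∀ j, |x j| ≤ t * sdev m j := by
    intro t x
    rw [hh, pi_norm_le_iff_of_nonempty]
    refine forall_congr' fun j => ?_
    rw [Real.norm_eq_abs, abs_div, abs_of_pos (hpos j), div_le_iff₀ (hpos j)]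
  have hbox : ∀ t, G.real {x | ∀ j, |x j| ≤ t * sdev m j} = cdf (G.map h) t := by
    intro t
    rw [cdf_eq_real, map_measureReal_apply hmeas measurableSet_Iic]
    congr 1
    ext x
    exact (hle t x).symm
  have hnull : ∀ c, (G.map h) {c} = 0 := by
    intro c
    rw [Measure.map_apply hmeas (measurableSet_singleton c)]
    -- On a level set of the maximum some coordinate takes one of two fixed values, which is a null
    -- event for a nondegenerate one-dimensional Gaussian. The joint law itself may be singular.
    refine measure_mono_null (t := ⋃ j, (fun x : EuclideanSpace ℝ (Fin M) => x j) ⁻¹'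
      {c * sdev m j, -(c * sdev m j)}) ?_ (measure_iUnion_null fun j => ?_)
    · intro x hx
      have hx' : h x = c := hx
      by_contra hcon
      simp only [Set.mem_iUnion, Set.mem_preimage, Set.mem_insert_iff, Set.mem_singleton_iff,
        not_exists, not_or] at hcon
      have hlt : ∀ j, |x j| < c * sdev m j := fun j =>
        lt_of_le_of_ne ((hle c x).1 hx'.le j) fun he => by
          rcases abs_choice (x j) with h1 | h1
          · exact (hcon j).1 (by rw [← h1, he])
          · exact (hcon j).2 (by rw [← he, h1, neg_neg])
      have hc : 0 < c := by
        have := (abs_nonneg _).trans_lt (hlt 0)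
        exact (pos_iff_pos_of_mul_pos this).2 (hpos 0)
      have : h x < c := by
        rw [hh, pi_norm_lt_iff hc]
        intro j
        rw [Real.norm_eq_abs, abs_div, abs_of_pos (hpos j), div_lt_iff₀ (hpos j)]
        exact hlt j
      exact this.ne hx'
    · have hmp := measurePreserving_eval_multivariateGaussian (μ := 0) hm (i := j)
      rw [hmp.measure_preimage ((Set.toFinite _).measurableSet.nullMeasurableSet)]
      have hv : (covMat m j j).toNNReal ≠ 0 := by
        have := Real.sqrt_pos.1 (hpos j)
        simp only [covMat, Matrix.of_apply, ne_eq, Real.toNNReal_eq_zero, not_le]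
        linarith
      have := nullSingletonClass_gaussianReal (μ := (0 : EuclideanSpace ℝ (Fin M)) j) hv
      exact (Set.toFinite _).measure_zero _
  have hcont : Continuous (cdf (G.map h)) := by
    rw [continuous_iff_continuousAt]
    intro c
    rw [(monotone_cdf _).continuousAt_iff_leftLim_eq_rightLim, StieltjesFunction.rightLim_eq]
    have h1 := (cdf (G.map h)).measure_singleton c
    rw [measure_cdf, hnull, eq_comm, ENNReal.ofReal_eq_zero] at h1
    have h2 := (monotone_cdf (G.map h)).leftLim_le (le_refl c)
    linarith
  obtain ⟨t, ht⟩ := mem_range_of_exists_le_of_exists_ge hcont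
    (((tendsto_cdf_atBot (G.map h)).eventually_le_const ha).exists)
    (((tendsto_cdf_atTop (G.map h)).eventually_const_le ha1).exists)
  exact ⟨t, (hbox t).trans ht⟩

lemma measurable_bootStat {N : ℕ} (y : Fin N → Outcome M) : Measurable (bootStat y) := by
  unfold bootStat
  refine Measurable.iSup fun j => ?_
  fun_prop

/-- The set defining the critical value is nonempty. -/
lemma critVal_set_nonempty {N : ℕ} (y : Fin N → Outcome M) {δα : ℝ} (h : 0 < δα) :
    {t : ℝ | 1 - δα ≤ (Measure.pi (fun _ : Fin N => gaussianReal 0 1)).real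
      {ξ | bootStat y ξ ≤ t}}.Nonempty := by
  set γ := Measure.pi (fun _ : Fin N => gaussianReal 0 1)
  have : IsProbabilityMeasure (γ.map (bootStat y)) :=
    Measure.isProbabilityMeasure_map (measurable_bootStat y).aemeasurable
  obtain ⟨t, ht⟩ := ((tendsto_cdf_atTop (γ.map (bootStat y))).eventually_const_le
    (by linarith : 1 - δα < 1)).exists
  rw [cdf_eq_real, map_measureReal_apply (measurable_bootStat y) measurableSet_Iic] at ht
  exact ⟨t, ht⟩

lemma bootStat_nonneg {N : ℕ} (y : Fin N → Outcome M) (ξ : Fin N → ℝ) : 0 ≤ bootStat y ξ :=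
  Real.iSup_nonneg fun _ => abs_nonneg _

lemma critVal_nonneg {N : ℕ} (y : Fin N → Outcome M) {δα : ℝ} (h : δα < 1) :
    0 ≤ critVal δα y := by
  refine Real.sInf_nonneg fun t ht => ?_
  by_contra hneg
  have : {ξ | bootStat y ξ ≤ t} = ∅ :=
    Set.eq_empty_of_forall_notMem fun ξ hξ => hneg ((bootStat_nonneg y ξ).trans hξ)
  have ht' : 1 - δα ≤ (Measure.pi (fun _ : Fin N => gaussianReal 0 1)).real
    {ξ | bootStat y ξ ≤ t} := ht
  rw [this, measureReal_empty] at ht'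
  linarith

/-- A lower bound on the critical value in terms of the law of the multiplier sum. -/
lemma le_sqrt_mul_critVal {N : ℕ} (hN : 1 ≤ N) {y : Fin N → Outcome M} {δα t : ℝ} (hδ : 0 < δα)
    {r : Fin M → ℝ} (hs : ∀ j, 0 < sHat y j) (hr : ∀ j, t * sHat y j ≤ r j)
    (hlaw : (bootLaw y).real {x | ∀ j, |x j| ≤ r j} < 1 - δα) :
    t ≤ √(N : ℝ) * critVal δα y := by
  have hN0 : (0 : ℝ) < N := by exact_mod_cast hN
  have hs0 : 0 < √(N : ℝ) := Real.sqrt_pos.2 hN0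
  rw [← div_le_iff₀' hs0]
  -- A level u < t/√N would put the event `bootStat ≤ u` inside the box with sides `r`, whose mass
  -- is too small. The sides are free so that a box independent of the data can be used in the weak
  -- limit.
  refine le_csInf (critVal_set_nonempty y hδ) fun u hu => ?_
  by_contra hlt
  rw [not_le] at hlt
  refine absurd (le_trans (Set.mem_ofPred_eq ▸ hu : 1 - δα ≤ _) ?_) (not_le.2 hlaw)
  have hclosed : MeasurableSet {x : EuclideanSpace ℝ (Fin M) | ∀ j, |x j| ≤ r j} := by
    rw [Set.ofPred_forall]
    refine MeasurableSet.iInter fun j => measurableSet_le (by fun_prop) measurable_const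
  rw [bootLaw, map_measureReal_apply (measurable_scaledSum y _) hclosed]
  refine measureReal_mono fun ξ hξ => ?_
  have hξ' : bootStat y ξ ≤ u := hξ
  intro j
  refine le_trans ?_ (hr j)
  have h1 : |(1 / (N : ℝ)) * ∑ i, ξ i * ((bit (y i j) - alphaHat y j) / sHat y j)| ≤ u :=
    (le_ciSup (Set.finite_range fun j : Fin M =>
      |(1 / (N : ℝ)) * ∑ i, ξ i * ((bit (y i j) - alphaHat y j) / sHat y j)|).bddAbove j).trans hξ'
  have e : scaledSum y (alphaHat y) ξ j = (√(N : ℝ) * sHat y j) *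
      ((1 / (N : ℝ)) * ∑ i, ξ i * ((bit (y i j) - alphaHat y j) / sHat y j)) := by
    have hsum : ∑ i, ξ i * ((bit (y i j) - alphaHat y j) / sHat y j) =
        (∑ i, ξ i * (bit (y i j) - alphaHat y j)) / sHat y j := by
      rw [Finset.sum_div]
      exact Finset.sum_congr rfl fun i _ => by ring
    rw [hsum]
    have : (√(N : ℝ))⁻¹ = √(N : ℝ) / N := by
      rw [eq_div_iff hN0.ne', inv_mul_eq_iff_eq_mul₀ hs0.ne', Real.mul_self_sqrt hN0.le]
    simp only [scaledSum, this]
    have := (hs j).ne'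
    field_simp
  rw [e, abs_mul, abs_of_pos (mul_pos hs0 (hs j))]
  calc _ ≤ √(N : ℝ) * sHat y j * (t / √(N : ℝ)) :=
        mul_le_mul_of_nonneg_left (h1.trans hlt.le) (mul_pos hs0 (hs j)).le
    _ = t * sHat y j := by field_simp

/-- The critical value is bounded below when the sample moments are close to given moments. -/
lemma exists_nhds_le_sqrt_mul_critVal {m : Fin M → Fin M → ℝ} (hm : (covMat m).PosSemidef)
    (hpos : ∀ j, 0 < sdev m j) {δα t t' : ℝ} (hδ : 0 < δα) (htt : t < t')
    (hG : (multivariateGaussian 0 (covMat m)).real {x | ∀ j, |x j| ≤ t' * sdev m j} < 1 - δα) :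
    ∃ ν, 0 < ν ∧ ∀ N : ℕ, 1 ≤ N → ∀ y : Fin N → Outcome M,
      (∀ j k, |sampleMoment y j k - m j k| ≤ ν) → t ≤ √(N : ℝ) * critVal δα y := by
  by_contra hcon
  push Not at hcon
  -- The sample sizes need not grow: the multiplier law is Gaussian at every `N`, and convergence of
  -- the sample moments is enough.
  choose N hN y hy hlt using fun n : ℕ => hcon (1 / ((n : ℝ) + 1)) (by positivity)
  have hconv : Tendsto (fun n => sampleMoment (y n)) atTop (𝓝 m) := by
    refine tendsto_pi_nhds.2 fun j => tendsto_pi_nhds.2 fun k => ?_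
    rw [tendsto_iff_norm_sub_tendsto_zero]
    exact squeeze_zero (fun n => norm_nonneg _) (fun n => hy n j k)
      tendsto_one_div_add_atTop_nhds_zero_nat
  have hs : ∀ j, Tendsto (fun n => sHat (y n) j) atTop (𝓝 (sdev m j)) := fun j => by
    simp only [← sdev_sampleMoment]
    exact (continuous_sdev j).continuousAt.tendsto.comp hconv
  have e1 : ∀ᶠ n in atTop, ∀ j, 0 < sHat (y n) j :=
    eventually_all.2 fun j => (hs j).eventually_const_lt (hpos j)
  have e2 : ∀ᶠ n in atTop, ∀ j, t * sHat (y n) j ≤ t' * sdev m j :=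
    eventually_all.2 fun j => ((hs j).const_mul t).eventually_le_const
      (mul_lt_mul_of_pos_right htt (hpos j))
  have hclosed : IsClosed {x : EuclideanSpace ℝ (Fin M) | ∀ j, |x j| ≤ t' * sdev m j} := by
    rw [Set.ofPred_forall]
    exact isClosed_iInter fun j => isClosed_le (by fun_prop) continuous_const
  have e3 : ∀ᶠ n in atTop,
      (bootLaw (y n)) {x | ∀ j, |x j| ≤ t' * sdev m j} < ENNReal.ofReal (1 - δα) := by
    have hG' : multivariateGaussian 0 (covMat m) {x | ∀ j, |x j| ≤ t' * sdev m j} <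
        ENNReal.ofReal (1 - δα) := (ENNReal.lt_ofReal_iff_toReal_lt (measure_ne_top _ _)).2 hG
    refine eventually_lt_of_limsup_lt (lt_of_le_of_lt
      (ProbabilityMeasure.limsup_measure_closed_le_of_tendsto (tendsto_bootLaw hm hN hconv)
        hclosed) hG')
  obtain ⟨n, h1, h2, h3⟩ := (e1.and (e2.and e3)).exists
  exact absurd (le_sqrt_mul_critVal (hN n) hδ h1 h2
    ((ENNReal.lt_ofReal_iff_toReal_lt (measure_ne_top _ _)).1 h3)) (not_le.2 (hlt n))

/-! ### Asymptotic coverage, uniformly in the law. -/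

lemma moment_deviation_le {N : ℕ} (hN : 1 ≤ N) (P : Measure (Outcome M)) [IsProbabilityMeasure P]
    {ν : ℝ} (hν : 0 < ν) :
    (Measure.pi fun _ : Fin N => P).real
      {y | ∃ j k, ν < |sampleMoment y j k - lawMoment P j k|} ≤ M * (M * (1 / (4 * N) / ν ^ 2)) := by
  have h1 : ∀ j k : Fin M, (Measure.pi fun _ : Fin N => P).real
      {y | ν < |sampleMoment y j k - lawMoment P j k|} ≤ 1 / (4 * N) / ν ^ 2 := by
    intro j k
    have hb : ∀ a : Outcome M, bit (a j) * bit (a k) ∈ Set.Icc (0 : ℝ) 1 := fun a =>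
      ⟨mul_nonneg (bit_mem _).1 (bit_mem _).1,
        mul_le_one₀ (bit_mem _).2 (bit_mem _).1 (bit_mem _).2⟩
    have h2 := integral_sq_mean_sub_le hN P hb
    simp only [← sampleMoment_eq, ← lawMoment_eq_integral] at h2
    have h3 := mul_meas_ge_le_integral_of_nonneg (μ := Measure.pi fun _ : Fin N => P)
      (f := fun y => (sampleMoment y j k - lawMoment P j k) ^ 2) (ae_of_all _ fun y => sq_nonneg _)
      .of_finite (ν ^ 2)
    rw [le_div_iff₀' (by positivity)]
    refine le_trans (mul_le_mul_of_nonneg_left (measureReal_mono fun y hy => ?_) (sq_nonneg _))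
      (h3.trans h2)
    have hy' : ν < |sampleMoment y j k - lawMoment P j k| := hy
    have := pow_le_pow_left₀ hν.le hy'.le 2
    rwa [sq_abs] at this
  simp only [Set.ofPred_exists]
  refine (measureReal_iUnion_fintype_le _).trans ?_
  refine (Finset.sum_le_card_nsmul _ _ (M * (1 / (4 * N) / ν ^ 2)) fun j _ =>
    (measureReal_iUnion_fintype_le _).trans
      ((Finset.sum_le_card_nsmul _ _ _ fun k _ => h1 j k).trans_eq ?_)).trans_eq ?_ <;> simp

/-- The event that the confidence region covers both the estimate and the truth. -/
def coverage (N : ℕ) (δα : ℝ) (P : Measure (Outcome M)) : Set (Fin N → Outcome M) :=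
  {y | alphaHat y ∈ confRegion δα y ∧ marginal P ∈ confRegion δα y}

lemma alphaHat_mem_confRegion {N : ℕ} (y : Fin N → Outcome M) {δα : ℝ} (h : δα < 1) :
    alphaHat y ∈ confRegion δα y := by
  intro j _
  have := mul_nonneg (critVal_nonneg y h) (Real.sqrt_nonneg (alphaHat y j * (1 - alphaHat y j)))
  have h2 : 0 ≤ critVal δα y * sHat y j := this
  constructor <;> linarith

lemma scaledSum_one_apply {N : ℕ} (hN : 1 ≤ N) (y : Fin N → Outcome M) (α : Fin M → ℝ)
    (j : Fin M) : scaledSum y α 1 j = √(N : ℝ) * (alphaHat y j - α j) := by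
  have hN0 : (0 : ℝ) < N := by exact_mod_cast hN
  have hs0 : 0 < √(N : ℝ) := Real.sqrt_pos.2 hN0
  have : (√(N : ℝ))⁻¹ = √(N : ℝ) / N := by
    rw [eq_div_iff hN0.ne', inv_mul_eq_iff_eq_mul₀ hs0.ne', Real.mul_self_sqrt hN0.le]
  simp [scaledSum, this, alphaHat]
  field_simp

lemma marginal_mem_confRegion {N : ℕ} (hN : 1 ≤ N) {y : Fin N → Outcome M} {α r : Fin M → ℝ}
    {δα t : ℝ} (hr : ∀ j, r j ≤ t * sHat y j) (ht : t ≤ √(N : ℝ) * critVal δα y)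
    (h : ∀ j, |scaledSum y α 1 j| ≤ r j) : α ∈ confRegion δα y := by
  have hs0 : 0 < √(N : ℝ) := Real.sqrt_pos.2 (by exact_mod_cast hN)
  intro j _
  have h1 : √(N : ℝ) * |alphaHat y j - α j| ≤ √(N : ℝ) * (critVal δα y * sHat y j) := by
    have h2 := (h j).trans (hr j)
    rw [scaledSum_one_apply hN, abs_mul, abs_of_pos hs0] at h2
    refine h2.trans ?_
    rw [← mul_assoc]
    exact mul_le_mul_of_nonneg_right ht (Real.sqrt_nonneg _)
  have h3 := abs_le.1 (le_of_mul_le_mul_left h1 hs0)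
  constructor <;> linarith [h3.1, h3.2]

/-- Asymptotic coverage along a sequence of laws whose second moments converge. -/
lemma eventually_coverage [NeZero M] {δα η κ : ℝ} (hδ : 0 < δα) (hδ1 : δα < 1) (hη : 0 < η)
    (hκ : 0 < κ) {N : ℕ → ℕ} (hN1 : ∀ k, 1 ≤ N k) (hN : Tendsto N atTop atTop)
    (P : ℕ → Measure (Outcome M)) [∀ k, IsProbabilityMeasure (P k)]
    (hP : ∀ k j, η < marginal (P k) j ∧ marginal (P k) j < 1 - η)
    {m : Fin M → Fin M → ℝ} (hm : Tendsto (fun k => lawMoment (P k)) atTop (𝓝 m)) :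
    ∀ᶠ k in atTop, 1 - δα - κ ≤
      (Measure.pi fun _ : Fin (N k) => P k).real (coverage (N k) δα (P k)) := by
  have hpsd : (covMat m).PosSemidef := posSemidef_covMat_of_tendsto
    (fun n => pairMoment_comm _ _) hm fun n =>
      posSemidef_covMat_pairMoment (fun _ => measureReal_nonneg) (sum_real_singleton (P n)) id
  have hjk : ∀ j k, Tendsto (fun n => lawMoment (P n) j k) atTop (𝓝 (m j k)) := fun j k =>
    tendsto_pi_nhds.1 (tendsto_pi_nhds.1 hm j) k
  have hpos : ∀ j, 0 < sdev m j := by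
    intro j
    have h1 : η ≤ m j j := ge_of_tendsto (hjk j j) (Eventually.of_forall fun n => by
      rw [lawMoment_self]; exact (hP n j).1.le)
    have h2 : m j j ≤ 1 - η := le_of_tendsto (hjk j j) (Eventually.of_forall fun n => by
      rw [lawMoment_self]; exact (hP n j).2.le)
    exact Real.sqrt_pos.2 (mul_pos (by linarith) (by linarith))
  set G := multivariateGaussian 0 (covMat m) with hG
  -- The cap at `1 - δα` keeps the masses prescribed below positive. The budget `c` is spent as 3c/4
  -- for the box and c/4 for the sample moments.
  set c := min κ (1 - δα) with hc
  have hc0 : 0 < c := lt_min hκ (by linarith)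
  have hcκ : c ≤ κ := min_le_left _ _
  have hcδ : c ≤ 1 - δα := min_le_right _ _
  obtain ⟨t₀, ht₀⟩ := exists_box_measure_eq hpsd hpos (a := 1 - δα - c / 2) (by linarith)
    (by linarith)
  obtain ⟨t₂, ht₂⟩ := exists_box_measure_eq hpsd hpos (a := 1 - δα - c / 4) (by linarith)
    (by linarith)
  have htt : t₀ < t₂ := by
    by_contra hle
    rw [not_lt] at hle
    have : G.real {x | ∀ j, |x j| ≤ t₂ * sdev m j} ≤ G.real {x | ∀ j, |x j| ≤ t₀ * sdev m j} :=
      measureReal_mono fun x hx j =>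
        (hx j).trans (mul_le_mul_of_nonneg_right hle (hpos j).le)
    rw [ht₀, ht₂] at this
    linarith
  -- Radii t₀ < t₁ < t₃ < t₂: the error lies in the `t₁` box, √N times the critical value is at
  -- least `t₃`, and the gaps absorb weak convergence and the estimated standard deviations.
  obtain ⟨t₁, h01, h12⟩ := exists_between htt
  obtain ⟨t₃, h13, h32⟩ := exists_between h12
  obtain ⟨ν₁, hν₁, hcrit⟩ := exists_nhds_le_sqrt_mul_critVal hpsd hpos hδ h32
    (by rw [← hG, ht₂]; linarith)
  have hnear : ∀ᶠ u in 𝓝 m, ∀ j, t₁ * sdev m j < t₃ * sdev u j :=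
    eventually_all.2 fun j => (((continuous_sdev j).tendsto m).const_mul t₃).eventually_const_lt
      (mul_lt_mul_of_pos_right h13 (hpos j))
  obtain ⟨ν₂, hν₂, hball⟩ := Metric.eventually_nhds_iff.1 hnear
  set ν := min ν₁ (ν₂ / 2) with hν
  have hν0 : 0 < ν := lt_min hν₁ (by linarith)
  have hopen : IsOpen {x : EuclideanSpace ℝ (Fin M) | ∀ j, |x j| < t₁ * sdev m j} := by
    rw [Set.ofPred_forall]
    exact isOpen_iInter_of_finite fun j => isOpen_lt (by fun_prop) continuous_const
  have hlow : 1 - δα - 3 * c / 4 <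
      G.real {x : EuclideanSpace ℝ (Fin M) | ∀ j, |x j| < t₁ * sdev m j} := by
    refine lt_of_lt_of_le (b := 1 - δα - c / 2) (by linarith) ?_
    rw [← ht₀]
    exact measureReal_mono fun x hx j =>
      lt_of_le_of_lt (hx j) (mul_lt_mul_of_pos_right h01 (hpos j))
  have hlow' : ENNReal.ofReal (1 - δα - 3 * c / 4) <
      G {x : EuclideanSpace ℝ (Fin M) | ∀ j, |x j| < t₁ * sdev m j} :=
    (ENNReal.ofReal_lt_iff_lt_toReal (by linarith) (measure_ne_top _ _)).2 hlow
  have e1 : ∀ᶠ k in atTop, ENNReal.ofReal (1 - δα - 3 * c / 4) <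
      sampleLaw (N k) (P k) {x | ∀ j, |x j| < t₁ * sdev m j} :=
    eventually_lt_of_lt_liminf (hlow'.trans_le
      (ProbabilityMeasure.le_liminf_measure_open_of_tendsto (tendsto_sampleLaw hpsd hN P hm) hopen))
  have e2 : ∀ᶠ k in atTop, ∀ i j, |lawMoment (P k) i j - m i j| ≤ ν / 2 :=
    eventually_all.2 fun i => eventually_all.2 fun j => by
      have := ((tendsto_iff_norm_sub_tendsto_zero.1 (hjk i j)).eventually_le_const
        (half_pos hν0))
      exact this
  have e3 : ∀ᶠ k in atTop, (M : ℝ) * (M * (1 / (4 * (N k : ℝ)) / (ν / 2) ^ 2)) ≤ c / 4 := by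
    have h1 : Tendsto (fun k => (M : ℝ) * (M * (1 / (4 * (N k : ℝ)) / (ν / 2) ^ 2))) atTop
        (𝓝 ((M : ℝ) * (M * (0 / (ν / 2) ^ 2)))) := by
      refine Tendsto.const_mul _ (Tendsto.const_mul _ (Tendsto.div_const ?_ _))
      simp only [one_div]
      exact tendsto_inv_atTop_zero.comp ((tendsto_natCast_atTop_atTop.comp hN).const_mul_atTop
        (by norm_num))
    refine h1.eventually_le_const ?_
    simp only [zero_div, mul_zero]
    linarith
  filter_upwards [e1, e2, e3] with k h1 h2 h3
  set Q := Measure.pi fun _ : Fin (N k) => P k with hQ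
  set A : Set (Fin (N k) → Outcome M) :=
    {y | ∀ j, |scaledSum y (marginal (P k)) 1 j| < t₁ * sdev m j} with hA
  set B : Set (Fin (N k) → Outcome M) :=
    {y | ∃ i j, ν / 2 < |sampleMoment y i j - lawMoment (P k) i j|} with hB
  have hQA : 1 - δα - 3 * c / 4 < Q.real A := by
    have := (ENNReal.ofReal_lt_iff_lt_toReal (by linarith) (measure_ne_top _ _)).1 h1
    rw [← Measure.real, sampleLaw, map_measureReal_apply (measurable_of_finite _)
      hopen.measurableSet] at this
    exact this
  have hQB : Q.real B ≤ c / 4 := (moment_deviation_le (hN1 k) (P k) (half_pos hν0)).trans h3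
  have hsub : A \ B ⊆ coverage (N k) δα (P k) := by
    rintro y ⟨hyA, hyB⟩
    have hyB' : ∀ i j, |sampleMoment y i j - lawMoment (P k) i j| ≤ ν / 2 := by
      intro i j
      by_contra hlt
      exact hyB ⟨i, j, not_le.1 hlt⟩
    have hclose : ∀ i j, |sampleMoment y i j - m i j| ≤ ν := fun i j =>
      (abs_sub_le _ (lawMoment (P k) i j) _).trans (by linarith [hyB' i j, h2 i j])
    have hdist : dist (sampleMoment y) m < ν₂ := by
      refine lt_of_le_of_lt (b := ν₂ / 2) ?_ (by linarith)
      rw [dist_pi_le_iff (by linarith)]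
      intro i
      rw [dist_pi_le_iff (by linarith)]
      intro j
      rw [Real.dist_eq]
      exact (hclose i j).trans (min_le_right _ _)
    refine ⟨alphaHat_mem_confRegion y hδ1, marginal_mem_confRegion (hN1 k)
      (r := fun j => t₁ * sdev m j) (t := t₃) (fun j => ?_)
      (hcrit _ (hN1 k) y fun i j => (hclose i j).trans (min_le_left _ _)) fun j => (hyA j).le⟩
    rw [← sdev_sampleMoment]
    exact (hball hdist j).le
  have hdiff : Q.real A ≤ Q.real (A \ B) + Q.real B := by
    refine (measureReal_mono (s₂ := A \ B ∪ B) ?_).trans (measureReal_union_le _ _)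
    rw [Set.sdiff_union_self]
    exact Set.subset_union_left
  have := measureReal_mono (μ := Q) hsub
  linarith

lemma lawMoment_mem_Icc (P : Measure (Outcome M)) [IsProbabilityMeasure P] :
    lawMoment P ∈ Set.Icc (0 : Fin M → Fin M → ℝ) 1 := by
  have h : ∀ j k, lawMoment P j k ∈ Set.Icc (0 : ℝ) 1 := by
    intro j k
    rw [← sum_real_singleton P]
    refine ⟨Finset.sum_nonneg fun a _ => mul_nonneg measureReal_nonneg
      (mul_nonneg (bit_mem _).1 (bit_mem _).1), Finset.sum_le_sum fun a _ => ?_⟩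
    exact mul_le_of_le_one_right measureReal_nonneg
      (mul_le_one₀ (bit_mem _).2 (bit_mem _).1 (bit_mem _).2)
  exact ⟨fun j k => (h j k).1, fun j k => (h j k).2⟩

/-- Asymptotic coverage, uniformly over all laws with marginals bounded away from `0` and `1`. -/
theorem uniform_coverage [NeZero M] {δα η κ : ℝ} (hδ : 0 < δα) (hδ1 : δα < 1) (hη : 0 < η)
    (hκ : 0 < κ) : ∃ N₀ : ℕ, ∀ N, N₀ ≤ N → ∀ P : Measure (Outcome M), IsProbabilityMeasure P →
      (∀ j, η < marginal P j ∧ marginal P j < 1 - η) →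
      1 - δα - κ ≤ (Measure.pi fun _ : Fin N => P).real (coverage N δα P) := by
  by_contra hcon
  push Not at hcon
  -- The shift by one ensures N ≥ 1 as well as divergence of the sample sizes.
  choose N hN P hPp hP hlt using fun k : ℕ => hcon (k + 1)
  obtain ⟨m, -, φ, hφ, hm⟩ := (isCompact_Icc (a := (0 : Fin M → Fin M → ℝ)) (b := 1)).tendsto_subseq
    fun k => (lawMoment_mem_Icc (P k))
  have hNt : Tendsto (fun k => N (φ k)) atTop atTop :=
    (tendsto_atTop_mono (fun k => (Nat.le_succ k).trans (hN k)) tendsto_id).comp hφ.tendsto_atTop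
  have := eventually_coverage hδ hδ1 hη hκ (N := fun k => N (φ k))
    (fun k => (Nat.succ_le_succ (Nat.zero_le _)).trans (hN (φ k))) hNt (fun k => P (φ k))
    (fun k => hP (φ k)) hm
  obtain ⟨k, hk⟩ := this.exists
  exact absurd hk (not_le.2 (hlt (φ k)))

/-- The largest shortfall of the coverage probability from its nominal level. -/
def coverageGap (M : ℕ) (η δα : ℝ) (N : ℕ) : ℝ :=
  sSup {x : ℝ | ∃ P : Measure (Outcome M), IsProbabilityMeasure P ∧
    (∀ j, η < marginal P j ∧ marginal P j < 1 - η) ∧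
    x = max 0 (1 - δα - (Measure.pi fun _ : Fin N => P).real (coverage N δα P))}

lemma le_coverageGap {η δα : ℝ} (hδ : 0 < δα) {N : ℕ} {P : Measure (Outcome M)}
    (hPp : IsProbabilityMeasure P) (hP : ∀ j, η < marginal P j ∧ marginal P j < 1 - η) :
    1 - δα - coverageGap M η δα N ≤
      (Measure.pi fun _ : Fin N => P).real (coverage N δα P) := by
  have hb : max 0 (1 - δα - (Measure.pi fun _ : Fin N => P).real (coverage N δα P)) ≤
      coverageGap M η δα N := by
    refine le_csSup ⟨1, ?_⟩ ⟨P, hPp, hP, rfl⟩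
    rintro _ ⟨P', -, -, rfl⟩
    have : 0 ≤ (Measure.pi fun _ : Fin N => P').real (coverage N δα P') := measureReal_nonneg
    exact max_le zero_le_one (by linarith)
  linarith [le_max_right 0 (1 - δα - (Measure.pi fun _ : Fin N => P).real (coverage N δα P))]

lemma tendsto_coverageGap [NeZero M] {η δα : ℝ} (hη : 0 < η) (hδ : 0 < δα) (hδ1 : δα < 1) :
    Tendsto (coverageGap M η δα) atTop (𝓝 0) := by
  have h0 : ∀ N, 0 ≤ coverageGap M η δα N := fun N => Real.sSup_nonneg (by
    rintro _ ⟨P, -, -, rfl⟩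
    exact le_max_left _ _)
  refine Metric.tendsto_atTop.2 fun κ hκ => ?_
  obtain ⟨N₀, hN₀⟩ := uniform_coverage (M := M) hδ hδ1 hη (half_pos hκ)
  refine ⟨N₀, fun N hN => ?_⟩
  rw [Real.dist_0_eq_abs, abs_of_nonneg (h0 N)]
  refine lt_of_le_of_lt (Real.sSup_le ?_ (half_pos hκ).le) (half_lt_self hκ)
  rintro _ ⟨P, hPp, hP, rfl⟩
  exact max_le (half_pos hκ).le (by linarith [hN₀ N hN P hPp hP])

end BinaryVec

end

theorem proposition1 :
    (∃ c₀ : ℝ, 0 < c₀ ∧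
      ∀ (M N : ℕ), 2 ≤ M → 1 ≤ N →
      ∀ (Ω : Type*) [MeasurableSpace Ω] (μ : Measure Ω) [IsProbabilityMeasure μ]
        (Y : Fin N → Ω → BinaryVec.Outcome M) (P : Measure (BinaryVec.Outcome M))
        (s : ℕ) (Lbar ε ξ η : ℝ),
        BinaryVec.Setting μ Y P s Lbar ε ξ η →
      ∀ δ : ℝ, 0 < δ → δ < 1 →
        1 - δ ≤ μ.real {ω |
          BinaryVec.vecNorm 1 (BinaryVec.alphaHat (fun i => Y i ω) - BinaryVec.marginal P) ≤
              M / √(N : ℝ) + c₀ * √(M * Real.log (1 / δ) * min Lbar (M / 4) / N) ∧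
          BinaryVec.vecNorm 2 (BinaryVec.alphaHat (fun i => Y i ω) - BinaryVec.marginal P) ≤
              √((M : ℝ) / N) + c₀ * √(Real.log (1 / δ) * min Lbar (M / 4) / N) ∧
          BinaryVec.vecNorm ⊤ (BinaryVec.alphaHat (fun i => Y i ω) - BinaryVec.marginal P) ≤
              c₀ * √(Real.log (M / δ) / N)}) ∧
    (∀ (M : ℕ), 2 ≤ M → ∀ (η δα : ℝ), 0 < δα → δα < 1 →
      ∃ ρ : ℕ → ℝ, Tendsto ρ atTop (𝓝 0) ∧
        ∀ (N : ℕ), 1 ≤ N →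
        ∀ (Ω : Type*) [MeasurableSpace Ω] (μ : Measure Ω) [IsProbabilityMeasure μ]
          (Y : Fin N → Ω → BinaryVec.Outcome M) (P : Measure (BinaryVec.Outcome M))
          (s : ℕ) (Lbar ε ξ : ℝ),
          BinaryVec.Setting μ Y P s Lbar ε ξ η →
          1 - δα - ρ N ≤ μ.real {ω |
            BinaryVec.alphaHat (fun i => Y i ω) ∈ BinaryVec.confRegion δα (fun i => Y i ω) ∧
            BinaryVec.marginal P ∈ BinaryVec.confRegion δα (fun i => Y i ω)}) := by
  refine ⟨⟨30, by norm_num, ?_⟩, ?_⟩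
  · intro M N hM hN Ω _ μ _ Y P s Lbar ε ξ η h δ h0 h1
    have := h.isProbabilityMeasure hN
    refine (BinaryVec.norm_bounds hM hN P h.marginal_mem_Ioo h.bounded h0 h1).trans_eq ?_
    exact (h.measureReal_eq _).symm
  · intro M hM η δα hδ hδ1
    have : NeZero M := ⟨by lia⟩
    by_cases hη : 0 < η
    -- The remainder is a supremum over laws on outcomes, so it depends neither on the probability
    -- space nor on `P`.
    · refine ⟨BinaryVec.coverageGap M η δα, BinaryVec.tendsto_coverageGap hη hδ hδ1, ?_⟩
      intro N hN Ω _ μ _ Y P s Lbar ε ξ h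
      refine (BinaryVec.le_coverageGap hδ (h.isProbabilityMeasure hN) h.marginal_mem).trans_eq ?_
      exact (h.measureReal_eq _).symm
    · refine ⟨0, tendsto_const_nhds, ?_⟩
      intro N hN Ω _ μ _ Y P s Lbar ε ξ h
      exact absurd h.eta_pos hη
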